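/- **Conventions.** $[i]=\{1,\dots,i\}$ and $|i|=\lceil\log_2(i+1)\rceil$. Vertices of trees are finite sequences of positive integers, $v\subseteq w$ means that $v$ is an initial segment of $w$, $v*i$ is the extension of $v$ by the entry $i$, and vertices are ordered lexicographically (a proper initial segment comes first). A rooted tree of height $\le h$ and $\le b$-branching is a nonempty set of sequences over $[b]$ of length $\le h$ that is closed under initial segments; its root is the empty sequence. **Proof system.** Formulas are in negation normal form, built from the constants $0,1$ and literals by binary $\lor,\land$ and unbounded $\bigvee,\bigwedge$; $\overline\varphi$ is the negation normal form of $\lnot\varphi$, and $|\varphi|$ is the number of occurrences of variables, constants and connectives in $\varphi$. A formula $\varphi$ is $p\Sigma_{d+1/2}(z)$ if $|\varphi|\le z$ and $\varphi$ consists of exactly $d$ alternating levels $\bigvee\bigwedge\bigvee\cdots$ of nonempty unbounded connectives, beginning with $\bigvee$, on top of formulas without $\bigvee,\bigwedge$ of size $\le\log_2 z$. A cedent is a finite set of formulas. An $LK^*_{d+1/2,c}$-derivation of a cedent $S$ is a finite rooted tree $\pi$ of height $\le c$, labeled by cedents of cardinality $\le c$, with $S$ at the root, such that the label $\Gamma$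 of each vertex follows from the labels of its children (in their order) by one of the following rules. All formulas displayed next to $\Gamma$ in a premise are required not to belong to $\Gamma$. - Initial cedent: no premise, where $x,\overline x\in\Gamma$ for a constant or variable $x$. - $\bigvee$-rule and $\lor$-rule: one premise $\Gamma,\varphi_{i_0}$, where $\bigvee_i\varphi_i\in\Gamma$, respectively $\varphi_1\lor\varphi_2\in\Gamma$. - $\bigwedge$-rule and $\land$-rule: premises $\Gamma,\varphi_i$ for all $i$, where $\bigwedge_i\varphi_i\in\Gamma$, respectively $\varphi_1\land\varphi_2\in\Gamma$. - Trivial cut: one premise $\Gamma,0$. - $p\Sigma_{d+1/2}$-induction: premises $\Gamma,\varphi_1$; $\Gamma,\overline{\varphi_1},\varphi_2$; …; $\Gamma,\overline{\varphi_{I-1}},\varphi_I$; $\Gamma,\overline{\varphi_I}$, where $I\ge1$ and each $\varphi_i$ is $p\Sigma_{d+1/2}(|\pi|)$. Here $|\pi|$, the size of $\pi$, is the sum of the sizes of all formulas in all labels. In the variables $r_{ph}$ ($p\in[n+1]$, $h\in[n]$), $ontoPHP^{n+1}_n$ is the cedent $$\Big\{\bigvee_{p}\bigwedge_{h}\lnot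 r_{ph},\ \bigvee_{p\ne p',\,h}(r_{ph}\land r_{p'h}),\ \bigvee_{h}\bigwedge_{p}\lnot r_{ph},\ \bigvee_{h\neq h',\,p}(r_{ph}\land r_{ph'})\Big\}.$$ **The game.** Matchings are partial matchings between the pigeons $[n+1]$ and the holes $[n]$; $M\perp M'$ means that $M\cup M'$ is not a matching. An $(n,C)$-tree is a rooted tree $T$ of height $\le C$ and $\le 2^{|n|^C}$-branching such that $v*k\in T$ and $l\in[k]$ imply $v*l\in T$. A position of $\mathcal G_2(n,C,T)$ is a labeling $L$ of a nonempty set $\mathrm{dom}(L)\subseteq T$ closed under initial segments, where $L(v)=(M,\vec A)$ consists of a matching $M$ of size $\le|n|^C\cdot height(v)$, with $height(v)$ the length of $v$, and a sequence $\vec A$ over $[2^{|n|^C}]$ of length $height(v)$, and where $v\subseteq w$ implies that the matching at $v$ is contained in the one at $w$ and the sequence at $v$ is an initial segment of the one at $w$. Let $c(L)=\max\mathrm{dom}(L)$. Initially only the root is labeled, by $(\emptyset,())$. A round at a position $L$ with $L(c(L))=(M,\vec A)$ runs as follows. Prover plays a set $Q$ of at most $|n|^C$ pigeons and holes. Delayer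 answers with an inclusion-minimal matching $M'$ covering $Q$. Prover plays $\langle o,x,B\rangle$ with $o\in[3]$, $B\in[2^{|n|^C}]$, and $x\in[2^{|n|^C}]$ if $o=1$, $x\subsetneq c(L)$ if $o\in\{2,3\}$. For $o\in\{2,3\}$ write $c(L)=x*k*\sigma$. - $o=1$: if $c(L)*x\notin T$, Prover loses. Otherwise, if $M\perp M'$, Prover wins. Otherwise the next position extends $L$ by labeling $c(L)*x$ with $(M\cup M',\vec A*B)$. - $o=2$: if $x*(k+1)\notin T$, Prover loses. Otherwise let $L(x)=(M'',\vec\alpha)$. If $M''\perp M'$, Prover wins. Otherwise the next position extends $L$ by labeling $x*(k+1)$ with $(M''\cup M',\vec\alpha*B)$. - $o=3$: if $x*(k-1)\notin\mathrm{dom}(L)$, Prover loses. Otherwise let $l$ be the greatest extension of $x*(k-1)$ in $\mathrm{dom}(L)$. If $l$ is a leaf of $T$, Prover loses. Otherwise let $L(l)=(M'',\vec\alpha)$. If $M''\perp M'$, Prover wins. Otherwise the next position is obtained from $L$ by deleting the labels of all $v\supseteq x*k$ and labeling $l*1$ with $(M''\cup M',\vec\alpha*B)$. An oblivious strategy of Prover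 is a pair of functions $(f_1,f_2)$ giving Prover's moves as $Q=f_1(c(L),M,\vec A)$ and $\langle o,x,B\rangle=f_2(c(L),M,\vec A,M')$, where $(M,\vec A)=L(c(L))$ (so they depend on nothing else), with values that are allowed moves. A strategy of Delayer is a function $g$ that assigns to every position $L$ and every set $Q$ of at most $|n|^C$ pigeons and holes an inclusion-minimal matching $g(L,Q)$ covering $Q$. The strategy $(f_1,f_2)$ beats $g$ if Prover wins, after finitely many rounds, the play in which both players follow these strategies. **Theorem.** Suppose that there are constants $c,K\in\mathbb N$ such that, for all sufficiently large $n$, $ontoPHP^{n+1}_n$ has an $LK^*_{2+1/2,c}$-derivation of size at most $2^{|n|^{K}}$. Then there is a constant $C>0$ such that, for all sufficiently large $n$, there are an $(n,C)$-tree $T$ and an oblivious strategy $(f_1,f_2)$ of Prover for $\mathcal G_2(n,C,T)$ that beats every strategy $g$ of Delayer. -/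

import Mathlib

open Filter

/-! ### Propositional formulas and cedents -/

/-- Propositional formulas in negation normal form over the variables `V`, with constants,
literals, binary connectives and unbounded connectives. -/
inductive Formula (V : Type) : Type
  | const (b : Bool) : Formula V
  | var (x : V) : Formula V
  | negVar (x : V) : Formula V
  | or (φ ψ : Formula V) : Formula V
  | and (φ ψ : Formula V) : Formula V
  | bigOr (I : ℕ) (φ : Fin I → Formula V) : Formula V
  | bigAnd (I : ℕ) (φ : Fin I → Formula V) : Formula V

namespace Formula

variable {V : Type}

noncomputable instance : DecidableEq (Formula V) := Classical.decEq _

/-- The complement: the canonical negation normal form of the negation. -/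
def compl : Formula V → Formula V
  | const b => const (!b)
  | var x => negVar x
  | negVar x => var x
  | or φ ψ => and φ.compl ψ.compl
  | and φ ψ => or φ.compl ψ.compl
  | bigOr I φ => bigAnd I fun i => (φ i).compl
  | bigAnd I φ => bigOr I fun i => (φ i).compl

/-- The size: the number of occurrences of variables, constants and connectives. -/
def size : Formula V → ℕ
  | const _ => 1
  | var _ => 1
  | negVar _ => 2
  | or φ ψ => 1 + φ.size + ψ.size
  | and φ ψ => 1 + φ.size + ψ.size
  | bigOr _ φ => 1 + ∑ i, (φ i).size
  | bigAnd _ φ => 1 + ∑ i, (φ i).size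

/-- No unbounded connective occurs. -/
def IsFlat : Formula V → Prop
  | const _ => True
  | var _ => True
  | negVar _ => True
  | or φ ψ => φ.IsFlat ∧ ψ.IsFlat
  | and φ ψ => φ.IsFlat ∧ ψ.IsFlat
  | bigOr _ _ => False
  | bigAnd _ _ => False

/-- `HasShape t true i φ`: `φ` consists of exactly `i` alternating blocks `⋁ ⋀ ⋁ …` of nonempty
unbounded connectives, beginning with `⋁`, on top of flat formulas of size at most `t`.
`HasShape t false i φ`: the same, beginning with `⋀`. -/
def HasShape (t : ℕ) : Bool → ℕ → Formula V → Prop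
  | _, 0, φ => φ.IsFlat ∧ φ.size ≤ t
  | true, i + 1, φ => ∃ (I : ℕ) (χ : Fin I → Formula V),
      0 < I ∧ φ = bigOr I χ ∧ ∀ j, HasShape t false i (χ j)
  | false, i + 1, φ => ∃ (I : ℕ) (χ : Fin I → Formula V),
      0 < I ∧ φ = bigAnd I χ ∧ ∀ j, HasShape t true i (χ j)

/-- `φ` is `pΣ_{i+1/2}(z)`. The sizes being integers, `size ≤ log₂ z` is expressed with the
integer part of the logarithm. -/
def IsPSigma (i z : ℕ) (φ : Formula V) : Prop :=
  φ.size ≤ z ∧ φ.HasShape (Nat.log 2 z) true i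

end Formula

/-- A cedent: a finite set of formulas, read as their disjunction. -/
abbrev Cedent (V : Type) := Finset (Formula V)

/-! ### Rooted trees

A vertex is a finite sequence of positive integers, the root is `[]`, the `i`-th child of `v` is
`v ++ [i]`, `v <+: w` says that `v` is an initial segment of `w`, and `<` on `List ℕ` is the
lexicographic order (a proper initial segment being smaller). -/

/-- `T` is a rooted tree of height `≤ h` and `≤ b`-branching. -/
def IsRootedTree (b h : ℕ) (T : Finset (List ℕ)) : Prop :=
  T.Nonempty ∧
  (∀ v ∈ T, v.length ≤ h ∧ ∀ a ∈ v, 1 ≤ a ∧ a ≤ b) ∧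
  ∀ v w : List ℕ, v <+: w → w ∈ T → v ∈ T

/-! ### The sequent calculus -/

/-- `Rule d z Γ Δs`: the cedent `Γ` is derived from the list of premises `Δs` (from left to right)
by one of the derivation rules of `LK*_{d+1/2}`, where the induction formulas are
`pΣ_{d+1/2}(z)`. -/
inductive Rule {V : Type} (d z : ℕ) : Cedent V → List (Cedent V) → Prop
  | initConst (Γ : Cedent V) (b : Bool) (h : Formula.const b ∈ Γ)
      (h' : (Formula.const b).compl ∈ Γ) : Rule d z Γ []
  | initVar (Γ : Cedent V) (x : V) (h : Formula.var x ∈ Γ)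
      (h' : (Formula.var x).compl ∈ Γ) : Rule d z Γ []
  | bigOr (Γ : Cedent V) (I : ℕ) (φ : Fin I → Formula V) (i₀ : Fin I)
      (h : Formula.bigOr I φ ∈ Γ) (h' : φ i₀ ∉ Γ) :
      Rule d z Γ [insert (φ i₀) Γ]
  | orLeft (Γ : Cedent V) (φ₁ φ₂ : Formula V) (h : Formula.or φ₁ φ₂ ∈ Γ) (h' : φ₁ ∉ Γ) :
      Rule d z Γ [insert φ₁ Γ]
  | orRight (Γ : Cedent V) (φ₁ φ₂ : Formula V) (h : Formula.or φ₁ φ₂ ∈ Γ) (h' : φ₂ ∉ Γ) :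
      Rule d z Γ [insert φ₂ Γ]
  | bigAnd (Γ : Cedent V) (I : ℕ) (φ : Fin I → Formula V)
      (h : Formula.bigAnd I φ ∈ Γ) (h' : ∀ i, φ i ∉ Γ) :
      Rule d z Γ (List.ofFn fun i => insert (φ i) Γ)
  | and (Γ : Cedent V) (φ₁ φ₂ : Formula V) (h : Formula.and φ₁ φ₂ ∈ Γ)
      (h₁ : φ₁ ∉ Γ) (h₂ : φ₂ ∉ Γ) :
      Rule d z Γ [insert φ₁ Γ, insert φ₂ Γ]
  | trivialCut (Γ : Cedent V) (h : Formula.const false ∉ Γ) :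
      Rule d z Γ [insert (Formula.const false) Γ]
  /-- Induction along `φ 0, …, φ m`: the premises are `Γ, φ 0`, then `Γ, (φ j).compl, φ (j+1)` for
  `j < m`, and finally `Γ, (φ m).compl`. -/
  | induction (Γ : Cedent V) (m : ℕ) (φ : ℕ → Formula V)
      (hφ : ∀ i ≤ m, (φ i).IsPSigma d z)
      (h : ∀ i ≤ m, φ i ∉ Γ ∧ (φ i).compl ∉ Γ) :
      Rule d z Γ ([insert (φ 0) Γ] ++
        (List.range m).map (fun j => insert (φ (j + 1)) (insert (φ j).compl Γ)) ++
        [insert (φ m).compl Γ])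

/-- A finite vertex-labeled tree; only the labels of the vertices in `tree` are meaningful. -/
structure LabeledTree (V : Type) where
  tree : Finset (List ℕ)
  label : List ℕ → Cedent V

/-- The size of a labeled tree: the sum of the sizes of all formulas in all its cedents. -/
def LabeledTree.size {V : Type} (π : LabeledTree V) : ℕ :=
  ∑ v ∈ π.tree, ∑ φ ∈ π.label v, φ.size

/-- `π` is an `LK*_{d+1/2,c}`-derivation of `S`. In the last clause `is` lists the indices of the
children of `v` in increasing order. -/
def IsDerivation {V : Type} (d c : ℕ) (π : LabeledTree V) (S : Cedent V) : Prop :=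
  (∃ b, IsRootedTree b c π.tree) ∧
  (∀ v ∈ π.tree, (π.label v).card ≤ c) ∧
  π.label [] = S ∧
  ∀ v ∈ π.tree, ∃ is : List ℕ, is.Pairwise (· < ·) ∧ (∀ i, i ∈ is ↔ v ++ [i] ∈ π.tree) ∧
    Rule d π.size (π.label v) (is.map fun i => π.label (v ++ [i]))

/-! ### The pigeonhole principle -/

/-- The disjunction of `φ t` for `t` running through a list. -/
def Formula.disj {V ι : Type} (l : List ι) (φ : ι → Formula V) : Formula V :=
  Formula.bigOr l.length fun i => φ (l.get i)

/-- All triples `(a, a', b)` with `a ≠ a'`. -/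
def distinctTriples (k l : ℕ) : List (Fin k × Fin k × Fin l) :=
  (List.product (List.finRange k) (List.product (List.finRange k) (List.finRange l))).filter
    fun t => t.1 ≠ t.2.1

/-- The cedent `ontoPHP^{n+1}_n` in the variables `r_{ph}`, for pigeons `p` and holes `h`. -/
noncomputable def ontoPHP (n : ℕ) : Cedent (Fin (n + 1) × Fin n) :=
  { .bigOr (n + 1) fun p => .bigAnd n fun h => .negVar (p, h),
    .disj (distinctTriples (n + 1) n) fun t => .and (.var (t.1, t.2.2)) (.var (t.2.1, t.2.2)),
    .bigOr n fun h => .bigAnd (n + 1) fun p => .negVar (p, h),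
    .disj (distinctTriples n (n + 1)) fun t => .and (.var (t.2.2, t.1)) (.var (t.2.2, t.2.1)) }

/-- `|n| = ⌈log₂ (n+1)⌉`, the length of the binary representation of `n`. -/
def binLen (n : ℕ) : ℕ := Nat.clog 2 (n + 1)

/-! ### Partial matchings -/

/-- A set of pairs (pigeon, hole). -/
abbrev EdgeSet (n : ℕ) := Finset (Fin (n + 1) × Fin n)

/-- `M` is a partial matching between the `n+1` pigeons and the `n` holes. -/
def IsMatching {n : ℕ} (M : EdgeSet n) : Prop :=
  ∀ e ∈ M, ∀ e' ∈ M, (e.1 = e'.1 ↔ e.2 = e'.2)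

/-- The matchings `M` and `M'` contradict each other. -/
def Contradicts {n : ℕ} (M M' : EdgeSet n) : Prop := ¬ IsMatching (M ∪ M')

/-- A query: a finite set of pigeons and holes. -/
abbrev Query (n : ℕ) := Finset (Fin (n + 1) ⊕ Fin n)

/-- `M` covers every pigeon and every hole in `Q`. -/
def Covers {n : ℕ} (M : EdgeSet n) (Q : Query n) : Prop :=
  (∀ p, Sum.inl p ∈ Q → ∃ h, (p, h) ∈ M) ∧ (∀ h, Sum.inr h ∈ Q → ∃ p, (p, h) ∈ M)

/-- `M` is an inclusion-minimal matching covering `Q`. -/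
def IsMinimalCover {n : ℕ} (Q : Query n) (M : EdgeSet n) : Prop :=
  Minimal (fun M => IsMatching M ∧ Covers M Q) M

/-! ### The game -/

/-- `T` is an `(n, C)`-tree. -/
def IsNCTree (n C : ℕ) (T : Finset (List ℕ)) : Prop :=
  IsRootedTree (2 ^ binLen n ^ C) C T ∧
  ∀ (v : List ℕ) (k l : ℕ), v ++ [k] ∈ T → 1 ≤ l → l ≤ k → v ++ [l] ∈ T

/-- A partial labeling of vertices by pairs `(M, A)`; `none` means undefined. -/
abbrev Labeling (n : ℕ) := List ℕ → Option (EdgeSet n × List ℕ)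

/-- The domain of a partial labeling. -/
def Labeling.dom {n : ℕ} (L : Labeling n) : Set (List ℕ) := {v | L v ≠ none}

/-- All entries of `A` belong to `[2^{|n|^C}] = {1, …, 2^{|n|^C}}`. -/
def EntriesBounded (n C : ℕ) (A : List ℕ) : Prop :=
  ∀ a ∈ A, 1 ≤ a ∧ a ≤ 2 ^ binLen n ^ C

/-- `L` is a possible position of the game on the tree `T`. -/
structure IsPosition (n C : ℕ) (T : Finset (List ℕ)) (L : Labeling n) : Prop where
  root_mem : [] ∈ L.dom
  dom_subset : ∀ v ∈ L.dom, v ∈ T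
  dom_closed : ∀ v w : List ℕ, v <+: w → w ∈ L.dom → v ∈ L.dom
  label_valid : ∀ v M A, L v = some (M, A) →
    IsMatching M ∧ M.card ≤ binLen n ^ C * v.length ∧
    A.length = v.length ∧ EntriesBounded n C A
  label_mono : ∀ v w M A M' A', v <+: w → L v = some (M, A) → L w = some (M', A') →
    M ⊆ M' ∧ A <+: A'

/-- The initial position: only the root is labeled, by the empty matching. -/
def initialPosition (n : ℕ) : Labeling n :=
  fun v => if v = [] then some (∅, []) else none

/-- Prover's moves `⟨o, x, B⟩`: `climb x B` for `o = 1`, `advance x B` for `o = 2`, and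
`backtrack x B` for `o = 3`. -/
inductive Move : Type
  | climb (x : ℕ) (B : ℕ) : Move
  | advance (x : List ℕ) (B : ℕ) : Move
  | backtrack (x : List ℕ) (B : ℕ) : Move

/-- The move is allowed when the current frontier is `v`. -/
def Move.IsLegal (n C : ℕ) (v : List ℕ) : Move → Prop
  | climb x B => (1 ≤ x ∧ x ≤ 2 ^ binLen n ^ C) ∧ 1 ≤ B ∧ B ≤ 2 ^ binLen n ^ C
  | advance x B => (x <+: v ∧ x ≠ v) ∧ 1 ≤ B ∧ B ≤ 2 ^ binLen n ^ C
  | backtrack x B => (x <+: v ∧ x ≠ v) ∧ 1 ≤ B ∧ B ≤ 2 ^ binLen n ^ C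

/-- The result of a round: the end of the game with a judgment, or the next position. -/
inductive Outcome (n : ℕ) : Type
  | proverWins : Outcome n
  | proverLoses : Outcome n
  | next (L : Labeling n) : Outcome n

/-- `Round T L M' mv out`: if Delayer has answered `M'` and Prover plays the move `mv` at the
position `L`, then the result is `out`. The frontier `c(L)` is the lexicographically greatest
vertex of the domain of `L`. -/
inductive Round {n : ℕ} (T : Finset (List ℕ)) (L : Labeling n) (M' : EdgeSet n) :
    Move → Outcome n → Prop
  | climb_lose (c : List ℕ) (x B : ℕ) (hc : IsGreatest L.dom c) (hT : c ++ [x] ∉ T) :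
      Round T L M' (.climb x B) .proverLoses
  | climb_win (c : List ℕ) (M : EdgeSet n) (A : List ℕ) (x B : ℕ)
      (hc : IsGreatest L.dom c) (hT : c ++ [x] ∈ T) (hL : L c = some (M, A))
      (hM : Contradicts M M') :
      Round T L M' (.climb x B) .proverWins
  | climb_next (c : List ℕ) (M : EdgeSet n) (A : List ℕ) (x B : ℕ)
      (hc : IsGreatest L.dom c) (hT : c ++ [x] ∈ T) (hL : L c = some (M, A))
      (hM : ¬ Contradicts M M') :
      Round T L M' (.climb x B)
        (.next (Function.update L (c ++ [x]) (some (M ∪ M', A ++ [B]))))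
  | advance_lose (x σ : List ℕ) (k B : ℕ) (hc : IsGreatest L.dom (x ++ [k] ++ σ))
      (hT : x ++ [k + 1] ∉ T) :
      Round T L M' (.advance x B) .proverLoses
  | advance_win (x σ : List ℕ) (k B : ℕ) (M : EdgeSet n) (A : List ℕ)
      (hc : IsGreatest L.dom (x ++ [k] ++ σ)) (hT : x ++ [k + 1] ∈ T)
      (hL : L x = some (M, A)) (hM : Contradicts M M') :
      Round T L M' (.advance x B) .proverWins
  | advance_next (x σ : List ℕ) (k B : ℕ) (M : EdgeSet n) (A : List ℕ)
      (hc : IsGreatest L.dom (x ++ [k] ++ σ)) (hT : x ++ [k + 1] ∈ T)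
      (hL : L x = some (M, A)) (hM : ¬ Contradicts M M') :
      Round T L M' (.advance x B)
        (.next (Function.update L (x ++ [k + 1]) (some (M ∪ M', A ++ [B]))))
  | backtrack_lose_left (x σ : List ℕ) (k B : ℕ) (hc : IsGreatest L.dom (x ++ [k] ++ σ))
      (hk : x ++ [k - 1] ∉ L.dom) :
      Round T L M' (.backtrack x B) .proverLoses
  | backtrack_lose_leaf (x σ l : List ℕ) (k B : ℕ) (hc : IsGreatest L.dom (x ++ [k] ++ σ))
      (hl : IsGreatest {w ∈ L.dom | x ++ [k - 1] <+: w} l) (hleaf : ∀ i, l ++ [i] ∉ T) :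
      Round T L M' (.backtrack x B) .proverLoses
  | backtrack_win (x σ l : List ℕ) (k B : ℕ) (M : EdgeSet n) (A : List ℕ)
      (hc : IsGreatest L.dom (x ++ [k] ++ σ))
      (hl : IsGreatest {w ∈ L.dom | x ++ [k - 1] <+: w} l) (hleaf : ∃ i, l ++ [i] ∈ T)
      (hL : L l = some (M, A)) (hM : Contradicts M M') :
      Round T L M' (.backtrack x B) .proverWins
  | backtrack_next (x σ l : List ℕ) (k B : ℕ) (M : EdgeSet n) (A : List ℕ)
      (hc : IsGreatest L.dom (x ++ [k] ++ σ))
      (hl : IsGreatest {w ∈ L.dom | x ++ [k - 1] <+: w} l) (hleaf : ∃ i, l ++ [i] ∈ T)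
      (hL : L l = some (M, A)) (hM : ¬ Contradicts M M') :
      Round T L M' (.backtrack x B)
        (.next (Function.update (fun w => if x ++ [k] <+: w then none else L w)
          (l ++ [1]) (some (M ∪ M', A ++ [B]))))

/-! ### Strategies -/

/-- The data of an oblivious strategy of Prover: both functions see only the frontier `v` and
its label `(M, A)`, and the second one also Delayer's current answer. -/
structure ProverStrategy (n : ℕ) where
  query : List ℕ → EdgeSet n → List ℕ → Query n
  move : List ℕ → EdgeSet n → List ℕ → EdgeSet n → Move

/-- The functions of `f` have the ranges required of an oblivious strategy. -/
def IsObliviousStrategy (n C : ℕ) (f : ProverStrategy n) : Prop :=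
  ∀ (v : List ℕ) (M : EdgeSet n) (A : List ℕ), v.length ≤ C → A.length = v.length →
    EntriesBounded n C v → EntriesBounded n C A → IsMatching M →
    (f.query v M A).card ≤ binLen n ^ C ∧
    ∀ M' : EdgeSet n, IsMatching M' → (f.move v M A M').IsLegal n C v

/-- `g` is a strategy of Delayer: at every possible position and for every admissible query it
answers with a minimal matching covering the query. -/
def IsDelayerStrategy (n C : ℕ) (T : Finset (List ℕ)) (g : Labeling n → Query n → EdgeSet n) :
    Prop :=
  ∀ L, IsPosition n C T L → ∀ Q : Query n, Q.card ≤ binLen n ^ C → IsMinimalCover Q (g L Q)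

/-- `PlayRound T f g L out`: the result of the round at the position `L` is `out`, if Prover
follows `f` and Delayer follows `g`. -/
def PlayRound {n : ℕ} (T : Finset (List ℕ)) (f : ProverStrategy n)
    (g : Labeling n → Query n → EdgeSet n) (L : Labeling n) (out : Outcome n) : Prop :=
  ∃ v M A, IsGreatest L.dom v ∧ L v = some (M, A) ∧
    Round T L (g L (f.query v M A)) (f.move v M A (g L (f.query v M A))) out

/-- Prover wins the play that starts at the given position, after finitely many rounds. -/
inductive WinsFrom {n : ℕ} (T : Finset (List ℕ)) (f : ProverStrategy n)
    (g : Labeling n → Query n → EdgeSet n) : Labeling n → Prop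
  | now (L : Labeling n) (h : PlayRound T f g L .proverWins) : WinsFrom T f g L
  | later (L L' : Labeling n) (h : PlayRound T f g L (.next L')) (h' : WinsFrom T f g L') :
      WinsFrom T f g L

/-- `f` beats `g` in the game on `T`. -/
def Beats {n : ℕ} (T : Finset (List ℕ)) (f : ProverStrategy n)
    (g : Labeling n → Query n → EdgeSet n) : Prop :=
  WinsFrom T f g (initialPosition n)

/-! Prover walks through the derivation, from the root upwards, along cedents all of whose formulas
are claimed to be false. The current matching falsifies the flat formulas; the falsity of a
conjunction is backed by the index of a conjunct, stored in the sequence `A`; the falsity of a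
disjunction is a universal claim, backed by nothing until one of its disjuncts is picked
(`Evidence`). An initial cedent cannot be reached in this way, since no matching falsifies both a
variable and its negation.

At the root all claims are universal, and an instance of a pigeonhole axiom is refuted by a query of
size at most two. At an induction Prover enters the first premise. If the `⋁`-rule later picks a
disjunct `⋀ψ` of an induction formula claimed to be false, no counterexample to `⋀ψ` is at hand.
Prover then reverses the claim: the play moves to the next premise, where the complement of the
induction formula is claimed to be false with the complement of `⋀ψ` as recorded conjunct, and the
old frontier is left in place. If the `⋁`-rule picks a disjunct of that recorded conjunct, a query
decides it. Should it be true, it yields the missing counterexample to `⋀ψ`, so Prover backtracks to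
the old frontier and climbs there. This analysis is `exists_query_goodMove`; `Rule.next_premise`
provides the premise to advance to. Good moves are found from the frontier data alone, hence the
strategy is oblivious.

`GameInvariant` adds to the evidence what makes backtracking possible, and `GameInvariant.playRound`
shows that each round preserves it or is won. A round that is not won adds a vertex to the domain
and deletes only lexicographically greater ones, so the domain increases in a linear order on the
subsets of the tree, and the play must end with a win. -/

namespace Formula

theorem compl_compl {V : Type} (φ : Formula V) : φ.compl.compl = φ := by
  induction φ <;> simp_all [compl]

theorem isFlat_compl {V : Type} (φ : Formula V) : φ.compl.IsFlat ↔ φ.IsFlat := by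
  induction φ <;> simp_all [compl, IsFlat]

theorem one_le_size {V : Type} (φ : Formula V) : 1 ≤ φ.size := by
  cases φ <;> simp [size] <;> omega

theorem le_size_bigOr {V : Type} {I : ℕ} (φ : Fin I → Formula V) : I ≤ (bigOr I φ).size := by
  have h := Finset.card_nsmul_le_sum Finset.univ (fun i => (φ i).size) 1
    fun i _ => one_le_size (φ i)
  simp only [size]
  simp at h
  omega

theorem le_size_bigAnd {V : Type} {I : ℕ} (φ : Fin I → Formula V) : I ≤ (bigAnd I φ).size :=
  le_size_bigOr φ

/-! ### Flat formulas under partial matchings -/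

variable {n : ℕ}

/-- The pigeons occurring in a flat formula. -/
def pigeons : Formula (Fin (n + 1) × Fin n) → Finset (Fin (n + 1))
  | const _ => ∅
  | var x => {x.1}
  | negVar x => {x.1}
  | or φ ψ => φ.pigeons ∪ ψ.pigeons
  | and φ ψ => φ.pigeons ∪ ψ.pigeons
  | bigOr _ _ => ∅
  | bigAnd _ _ => ∅

theorem pigeons_compl (φ : Formula (Fin (n + 1) × Fin n)) : φ.compl.pigeons = φ.pigeons := by
  induction φ <;> simp_all [compl, pigeons]

theorem card_pigeons_le_size (φ : Formula (Fin (n + 1) × Fin n)) :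
    φ.pigeons.card ≤ φ.size := by
  induction φ with
  | or φ ψ h₁ h₂ =>
    have := Finset.card_union_le φ.pigeons ψ.pigeons
    simp only [pigeons, size]; omega
  | and φ ψ h₁ h₂ =>
    have := Finset.card_union_le φ.pigeons ψ.pigeons
    simp only [pigeons, size]; omega
  | _ => simp [pigeons, size]

/-- The partial assignment given by the matching `M` makes the flat formula false. -/
def Falsified (M : EdgeSet n) : Formula (Fin (n + 1) × Fin n) → Prop
  | const b => b = false
  | var x => ∃ e ∈ M, (e.1 = x.1 ∧ e.2 ≠ x.2) ∨ (e.1 ≠ x.1 ∧ e.2 = x.2)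
  | negVar x => x ∈ M
  | or φ ψ => φ.Falsified M ∧ ψ.Falsified M
  | and φ ψ => φ.Falsified M ∨ ψ.Falsified M
  | bigOr _ _ => False
  | bigAnd _ _ => False

theorem Falsified.mono {M N : EdgeSet n} (hMN : M ⊆ N) {φ : Formula (Fin (n + 1) × Fin n)}
    (h : φ.Falsified M) : φ.Falsified N := by
  induction φ with
  | const b => exact h
  | var x => obtain ⟨e, he, h⟩ := h; exact ⟨e, hMN he, h⟩
  | negVar x => exact hMN h
  | or φ ψ h₁ h₂ => exact ⟨h₁ h.1, h₂ h.2⟩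
  | and φ ψ h₁ h₂ => exact h.imp h₁ h₂
  | bigOr => exact h
  | bigAnd => exact h

/-- A set of edges covering all pigeons of a flat formula decides it. -/
theorem falsified_or_falsified_compl {M : EdgeSet n} {φ : Formula (Fin (n + 1) × Fin n)}
    (hφ : φ.IsFlat) (hM : ∀ p ∈ φ.pigeons, ∃ h, (p, h) ∈ M) :
    φ.Falsified M ∨ φ.compl.Falsified M := by
  induction φ with
  | const b => cases b <;> simp [Falsified, compl]
  | var x =>
    obtain ⟨h, hh⟩ := hM x.1 (by simp [pigeons])
    by_cases hx : h = x.2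
    · right; subst hx; exact hh
    · left; exact ⟨_, hh, .inl ⟨rfl, hx⟩⟩
  | negVar x =>
    obtain ⟨h, hh⟩ := hM x.1 (by simp [pigeons])
    by_cases hx : h = x.2
    · left; subst hx; exact hh
    · right; exact ⟨_, hh, .inl ⟨rfl, hx⟩⟩
  | or φ ψ h₁ h₂ =>
    have h₁ := h₁ hφ.1 fun p hp => hM p (by simp [pigeons, hp])
    have h₂ := h₂ hφ.2 fun p hp => hM p (by simp [pigeons, hp])
    simp only [Falsified, compl]; tauto
  | and φ ψ h₁ h₂ =>
    have h₁ := h₁ hφ.1 fun p hp => hM p (by simp [pigeons, hp])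
    have h₂ := h₂ hφ.2 fun p hp => hM p (by simp [pigeons, hp])
    simp only [Falsified, compl]; tauto
  | bigOr => exact hφ.elim
  | bigAnd => exact hφ.elim

/-! ### Formulas of low depth -/

/-- Flat formulas with at most `t` pigeons. -/
def IsSmall (t : ℕ) (φ : Formula (Fin (n + 1) × Fin n)) : Prop :=
  φ.IsFlat ∧ φ.pigeons.card ≤ t

theorem IsSmall.compl {t : ℕ} {φ : Formula (Fin (n + 1) × Fin n)} (h : φ.IsSmall t) :
    φ.compl.IsSmall t := by
  rwa [IsSmall, isFlat_compl, pigeons_compl]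

/-- At most two alternating unbounded connectives on top of small formulas. -/
inductive IsShallow (t : ℕ) : Formula (Fin (n + 1) × Fin n) → Prop
  | small (φ : Formula (Fin (n + 1) × Fin n)) (h : φ.IsSmall t) : IsShallow t φ
  | or (I : ℕ) (χ : Fin I → Formula (Fin (n + 1) × Fin n)) (h : ∀ i, (χ i).IsSmall t) :
      IsShallow t (bigOr I χ)
  | and (I : ℕ) (χ : Fin I → Formula (Fin (n + 1) × Fin n)) (h : ∀ i, (χ i).IsSmall t) :
      IsShallow t (bigAnd I χ)
  | orAnd (I : ℕ) (J : Fin I → ℕ) (χ : ∀ i, Fin (J i) → Formula (Fin (n + 1) × Fin n))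
      (h : ∀ i j, (χ i j).IsSmall t) : IsShallow t (bigOr I fun i => bigAnd (J i) (χ i))
  | andOr (I : ℕ) (J : Fin I → ℕ) (χ : ∀ i, Fin (J i) → Formula (Fin (n + 1) × Fin n))
      (h : ∀ i j, (χ i j).IsSmall t) : IsShallow t (bigAnd I fun i => bigOr (J i) (χ i))

theorem IsShallow.of_bigOr {t I : ℕ} {φ : Fin I → Formula (Fin (n + 1) × Fin n)}
    (h : IsShallow t (bigOr I φ)) (i : Fin I) :
    (φ i).IsSmall t ∨ ∃ J χ, φ i = bigAnd J χ ∧ ∀ j, (χ j).IsSmall t := by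
  cases h with
  | small _ h => exact h.1.elim
  | or _ _ h => exact .inl (h i)
  | orAnd _ _ _ h => exact .inr ⟨_, _, rfl, h i⟩

theorem IsShallow.of_bigAnd {t I : ℕ} {φ : Fin I → Formula (Fin (n + 1) × Fin n)}
    (h : IsShallow t (bigAnd I φ)) (i : Fin I) :
    (φ i).IsSmall t ∨ ∃ J χ, φ i = bigOr J χ ∧ ∀ j, (χ j).IsSmall t := by
  cases h with
  | small _ h => exact h.1.elim
  | and _ _ h => exact .inl (h i)
  | andOr _ _ _ h => exact .inr ⟨_, _, rfl, h i⟩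

theorem IsShallow.of_or {t : ℕ} {φ ψ : Formula (Fin (n + 1) × Fin n)}
    (h : IsShallow t (.or φ ψ)) : φ.IsSmall t ∧ ψ.IsSmall t := by
  cases h with
  | small _ h =>
    exact ⟨⟨h.1.1, (Finset.card_le_card Finset.subset_union_left).trans h.2⟩,
      ⟨h.1.2, (Finset.card_le_card Finset.subset_union_right).trans h.2⟩⟩

theorem IsShallow.of_and {t : ℕ} {φ ψ : Formula (Fin (n + 1) × Fin n)}
    (h : IsShallow t (.and φ ψ)) : φ.IsSmall t ∧ ψ.IsSmall t := by
  cases h with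
  | small _ h =>
    exact ⟨⟨h.1.1, (Finset.card_le_card Finset.subset_union_left).trans h.2⟩,
      ⟨h.1.2, (Finset.card_le_card Finset.subset_union_right).trans h.2⟩⟩

theorem IsShallow.compl {t : ℕ} {φ : Formula (Fin (n + 1) × Fin n)} (h : φ.IsShallow t) :
    φ.compl.IsShallow t := by
  cases h with
  | small _ h => exact .small _ h.compl
  | or _ _ h => exact .and _ _ fun i => (h i).compl
  | and _ _ h => exact .or _ _ fun i => (h i).compl
  | orAnd _ _ _ h => exact .andOr _ _ _ fun i j => (h i j).compl
  | andOr _ _ _ h => exact .orAnd _ _ _ fun i j => (h i j).compl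

/-- A flat formula mentions no more pigeons than its size, so the logarithmic size bound becomes a
bound on the queries needed to decide it. -/
theorem IsPSigma.exists_orAnd {z t : ℕ} (hz : Nat.log 2 z ≤ t)
    {φ : Formula (Fin (n + 1) × Fin n)} (h : φ.IsPSigma 2 z) :
    ∃ (I : ℕ) (J : Fin I → ℕ) (χ : ∀ i, Fin (J i) → Formula (Fin (n + 1) × Fin n)),
      φ = (bigOr I fun i => bigAnd (J i) (χ i)) ∧ ∀ i j, (χ i j).IsSmall t := by
  obtain ⟨-, I, χ, -, rfl, h⟩ := h
  simp only [HasShape] at h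
  choose J ψ _ hψ h using h
  refine ⟨I, J, ψ, congrArg _ (funext hψ), fun i j => ⟨(h i j).1, ?_⟩⟩
  exact (card_pigeons_le_size _).trans ((h i j).2.trans hz)

end Formula

theorem isShallow_of_mem_ontoPHP {n t : ℕ} (ht : 2 ≤ t) {φ : Formula (Fin (n + 1) × Fin n)}
    (h : φ ∈ ontoPHP n) : φ.IsShallow t := by
  simp only [ontoPHP, Finset.mem_insert, Finset.mem_singleton] at h
  rcases h with rfl | rfl | rfl | rfl
  · exact .orAnd _ _ _ fun i j => ⟨trivial, by simp [Formula.pigeons]; omega⟩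
  · exact .or _ _ fun i => ⟨⟨trivial, trivial⟩, (Finset.card_le_two).trans ht⟩
  · exact .orAnd _ _ _ fun i j => ⟨trivial, by simp [Formula.pigeons]; omega⟩
  · exact .or _ _ fun i => ⟨⟨trivial, trivial⟩, (Finset.card_le_two).trans ht⟩

theorem exists_bigOr_of_mem_ontoPHP {n : ℕ} {φ : Formula (Fin (n + 1) × Fin n)}
    (h : φ ∈ ontoPHP n) : ∃ I χ, φ = .bigOr I χ := by
  simp only [ontoPHP, Finset.mem_insert, Finset.mem_singleton] at h
  rcases h with rfl | rfl | rfl | rfl <;> exact ⟨_, _, rfl⟩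

/-! ### Rules -/

theorem getElem?_induction_premises {α : Type*} (a b : α) (f : ℕ → α) (m k : ℕ) :
    ([a] ++ (List.range m).map f ++ [b])[k + 1]? =
      if k < m then some (f k) else if k = m then some b else none := by
  rw [List.append_assoc, List.singleton_append, List.getElem?_cons_succ, List.getElem?_append]
  simp only [List.length_map, List.length_range]
  split_ifs with h h'
  · simp [h]
  · simp [h']
  · rw [List.getElem?_eq_none]; simp; omega

namespace Rule

theorem subset {V : Type} {d z : ℕ} {Γ : Cedent V} {Δs : List (Cedent V)} (h : Rule d z Γ Δs)
    {Δ : Cedent V} (hΔ : Δ ∈ Δs) : Γ ⊆ Δ := by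
  cases h <;> simp at hΔ
  case bigOr => subst hΔ; exact Finset.subset_insert _ _
  case orLeft => subst hΔ; exact Finset.subset_insert _ _
  case orRight => subst hΔ; exact Finset.subset_insert _ _
  case bigAnd => obtain ⟨i, rfl⟩ := hΔ; exact Finset.subset_insert _ _
  case and => rcases hΔ with rfl | rfl <;> exact Finset.subset_insert _ _
  case trivialCut => subst hΔ; exact Finset.subset_insert _ _
  case induction =>
    rcases hΔ with rfl | ⟨j, -, rfl⟩ | rfl
    · exact Finset.subset_insert _ _
    · exact (Finset.subset_insert _ _).trans (Finset.subset_insert _ _)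
    · exact Finset.subset_insert _ _

variable {n z t : ℕ} {Γ Δ : Cedent (Fin (n + 1) × Fin n)}
  {Δs : List (Cedent (Fin (n + 1) × Fin n))}

/-- Subformula property: apart from the constant of the trivial cut, new formulas are immediate
subformulas of old ones, or induction formulas and their complements. -/
theorem isShallow (hz : Nat.log 2 z ≤ t) (h : Rule 2 z Γ Δs) (hΓ : ∀ φ ∈ Γ, φ.IsShallow t)
    (hΔ : Δ ∈ Δs) : ∀ φ ∈ Δ, φ.IsShallow t := by
  have key : ∀ ψ : Formula (Fin (n + 1) × Fin n), ψ.IsShallow t →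
      ∀ φ ∈ insert ψ Γ, φ.IsShallow t := by
    intro ψ hψ φ hφ
    rcases Finset.mem_insert.1 hφ with rfl | hφ
    exacts [hψ, hΓ _ hφ]
  have ps : ∀ ψ : Formula (Fin (n + 1) × Fin n), ψ.IsPSigma 2 z → ψ.IsShallow t := by
    intro ψ hψ
    obtain ⟨I, J, χ, rfl, h⟩ := hψ.exists_orAnd hz
    exact .orAnd _ _ _ h
  cases h <;> simp at hΔ
  case bigOr I φ i₀ h h' =>
    subst hΔ
    refine key _ ?_
    rcases (hΓ _ h).of_bigOr i₀ with h | ⟨J, χ, e, h⟩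
    · exact .small _ h
    · rw [e]; exact .and _ _ h
  case orLeft h h' => subst hΔ; exact key _ (.small _ (hΓ _ h).of_or.1)
  case orRight h h' => subst hΔ; exact key _ (.small _ (hΓ _ h).of_or.2)
  case bigAnd I φ h h' =>
    obtain ⟨i, rfl⟩ := hΔ
    refine key _ ?_
    rcases (hΓ _ h).of_bigAnd i with h | ⟨J, χ, e, h⟩
    · exact .small _ h
    · rw [e]; exact .or _ _ h
  case and h _ _ =>
    rcases hΔ with rfl | rfl
    · exact key _ (.small _ (hΓ _ h).of_and.1)
    · exact key _ (.small _ (hΓ _ h).of_and.2)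
  case trivialCut => subst hΔ; exact key _ (.small _ ⟨trivial, by simp [Formula.pigeons]⟩)
  case induction m φ hφ h =>
    rcases hΔ with rfl | ⟨j, hj, rfl⟩ | rfl
    · exact key _ (ps _ (hφ 0 (by omega)))
    · intro ψ hψ
      rcases Finset.mem_insert.1 hψ with rfl | hψ
      · exact ps _ (hφ _ (by omega))
      · exact key _ (ps _ (hφ j (by omega))).compl _ hψ
    · exact key _ (ps _ (hφ m le_rfl)).compl

/-- A new disjunction of conjunctions is an induction formula, and its complement is the only
conjunction that is new in the next premise. -/
theorem next_premise (hz : Nat.log 2 z ≤ t) (h : Rule 2 z Γ Δs) (hΓ : ∀ φ ∈ Γ, φ.IsShallow t)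
    {k : ℕ} (hk : Δs[k]? = some Δ) {I : ℕ} {φ : Fin I → Formula (Fin (n + 1) × Fin n)}
    (hφ : .bigOr I φ ∈ Δ) (hφ' : .bigOr I φ ∉ Γ) (i : Fin I) (hi : ¬ (φ i).IsFlat) :
    ∃ Δ', Δs[k + 1]? = some Δ' ∧ ∀ ψ ∈ Δ', ψ ∈ Γ ∨ ψ = (Formula.bigOr I φ).compl ∨
      ∃ J χ, ψ = .bigOr J χ ∧ ∀ j, ¬ (χ j).IsFlat := by
  have single : ∀ ψ : Formula (Fin (n + 1) × Fin n), .bigOr I φ ∈ insert ψ Γ →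
      .bigOr I φ = ψ := fun ψ h => (Finset.mem_insert.1 h).resolve_right hφ'
  have big : ∀ ψ : Formula (Fin (n + 1) × Fin n), ψ.IsFlat → .bigOr I φ ∉ insert ψ Γ := by
    intro ψ hψ h
    rw [← single _ h] at hψ
    exact hψ
  have hmem := List.mem_of_getElem? hk
  cases h
  case initConst => simp at hk
  case initVar => simp at hk
  case bigOr I' φ' i₀ h h' =>
    simp at hmem; subst hmem
    rcases (hΓ _ h).of_bigOr i₀ with h | ⟨J, χ, e, h⟩
    · exact (big _ h.1 hφ).elim
    · rw [e] at hφ; simpa using single _ hφ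
  case orLeft h h' => simp at hmem; subst hmem; exact (big _ (hΓ _ h).of_or.1.1 hφ).elim
  case orRight h h' => simp at hmem; subst hmem; exact (big _ (hΓ _ h).of_or.2.1 hφ).elim
  case bigAnd I' φ' h h' =>
    simp at hmem
    obtain ⟨i', rfl⟩ := hmem
    rcases (hΓ _ h).of_bigAnd i' with h | ⟨J, χ, e, h⟩
    · exact (big _ h.1 hφ).elim
    -- The `⋀`-rule only adds disjunctions of flat formulas, which `hi` excludes.
    · rw [e] at hφ
      cases single _ hφ
      exact (hi (h i).1).elim
  case and h _ _ =>
    simp at hmem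
    rcases hmem with rfl | rfl
    · exact (big _ (hΓ _ h).of_and.1.1 hφ).elim
    · exact (big _ (hΓ _ h).of_and.2.1 hφ).elim
  case trivialCut => simp at hmem; subst hmem; exact (big (.const false) trivial hφ).elim
  case induction m φs hφs h =>
    -- Complements of induction formulas begin with `⋀`, so the new disjunction is the positive
    -- induction formula of premise `k`; the last premise has none.
    have compl_ne : ∀ j ≤ m, .bigOr I φ ≠ (φs j).compl := by
      intro j hj
      obtain ⟨I, J, χ, e, -⟩ := (hφs j hj).exists_orAnd hz
      rw [e]; simp [Formula.compl]
    have hk' : .bigOr I φ = φs k ∧ k ≤ m := by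
      cases k with
      | zero =>
        simp at hk; subst hk
        exact ⟨single _ hφ, Nat.zero_le _⟩
      | succ k =>
        rw [getElem?_induction_premises] at hk
        split_ifs at hk with h₁ h₂
        · cases hk
          rcases Finset.mem_insert.1 hφ with e | hφ
          · exact ⟨e, h₁⟩
          · exact (compl_ne k h₁.le (single _ hφ)).elim
        · cases hk
          exact (compl_ne m le_rfl (single _ hφ)).elim
    obtain ⟨e, hkm⟩ := hk'
    rw [getElem?_induction_premises]
    rcases hkm.lt_or_eq with hlt | rfl
    · rw [if_pos hlt]
      refine ⟨_, rfl, fun ψ hψ => ?_⟩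
      rw [Finset.mem_insert, Finset.mem_insert] at hψ
      rcases hψ with rfl | rfl | hψ
      · obtain ⟨I, J, χ, e, -⟩ := (hφs (k + 1) hlt).exists_orAnd hz
        exact .inr (.inr ⟨_, _, e, fun j h => h⟩)
      · rw [e]; exact .inr (.inl rfl)
      · exact .inl hψ
    · simp only [lt_irrefl, if_false, if_true]
      refine ⟨_, rfl, fun ψ hψ => ?_⟩
      rcases Finset.mem_insert.1 hψ with rfl | hψ
      · rw [e]; exact .inr (.inl rfl)
      · exact .inl hψ

end Rule

/-! ### Lexicographic order -/

namespace List

theorem lt_of_prefix_of_prefix_succ {x v w : List ℕ} {k : ℕ} (hv : x ++ [k] <+: v)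
    (hw : x ++ [k + 1] <+: w) : v < w := by
  obtain ⟨a, rfl⟩ := hv
  obtain ⟨b, rfl⟩ := hw
  induction x with
  | nil => simp [List.cons_lt_cons_iff]
  | cons y x ih => simpa [List.cons_lt_cons_iff] using ih

theorem lt_append_singleton (v : List ℕ) (k : ℕ) : v < v ++ [k] := by
  induction v with
  | nil => simp
  | cons y x ih => simpa [List.cons_lt_cons_iff] using ih

/-- The subtrees of adjacent siblings are adjacent intervals of the lexicographic order. After
backtracking, this makes the new vertex the greatest one. -/
theorem prefix_of_le_of_le {x v w u : List ℕ} {k : ℕ} (hv : x ++ [k] <+: v)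
    (hw : x ++ [k + 1] <+: w) (h₁ : v ≤ u) (h₂ : u ≤ w) :
    x ++ [k] <+: u ∨ x ++ [k + 1] <+: u := by
  obtain ⟨a, rfl⟩ := hv
  obtain ⟨b, rfl⟩ := hw
  rw [← not_lt] at h₁ h₂
  induction x generalizing u with
  | nil =>
    cases u with
    | nil => simp at h₁
    | cons c u =>
      simp [List.cons_lt_cons_iff] at h₁ h₂
      simp; omega
  | cons y x ih =>
    cases u with
    | nil => simp at h₁
    | cons c u =>
      simp [List.cons_lt_cons_iff] at h₁ h₂
      have hc : c = y := by omega
      subst hc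
      simpa using ih (u := u) (by simpa using h₁) (by simpa using h₂)

end List

/-! ### Normalized derivations -/

/-- A derivation of `ontoPHP n` of height at most `c` and size at most `z` on a tree in which the
children of every vertex are numbered consecutively from `1`. -/
structure IsNormalProof (n c z : ℕ) (T : Finset (List ℕ))
    (Γ : List ℕ → Cedent (Fin (n + 1) × Fin n)) : Prop where
  rooted : IsRootedTree z c T
  root : Γ [] = ontoPHP n
  rule : ∀ v ∈ T, ∃ Δs, Rule 2 z (Γ v) Δs ∧
    ∀ k Δ, Δs[k]? = some Δ ↔ v ++ [k + 1] ∈ T ∧ Γ (v ++ [k + 1]) = Δ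
  size_le : ∀ v ∈ T, ∀ φ ∈ Γ v, φ.size ≤ z

theorem LabeledTree.formula_size_le {V : Type} (π : LabeledTree V) {v : List ℕ}
    (hv : v ∈ π.tree) {φ : Formula V} (hφ : φ ∈ π.label v) : φ.size ≤ π.size :=
  (Finset.single_le_sum (f := fun φ : Formula V => φ.size) (fun _ _ => Nat.zero_le _) hφ).trans
    (Finset.single_le_sum (f := fun v => ∑ φ ∈ π.label v, φ.size) (fun _ _ => Nat.zero_le _) hv)

theorem IsDerivation.label_subset {V : Type} {d c : ℕ} {π : LabeledTree V} {S : Cedent V}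
    (hπ : IsDerivation d c π S) {v : List ℕ} (hv : v ∈ π.tree) : S ⊆ π.label v := by
  obtain ⟨⟨b, -, -, hclosed⟩, -, hroot, hrule⟩ := hπ
  induction v using List.reverseRecOn with
  | nil => rw [hroot]
  | append_singleton v i ih =>
    have hv' := hclosed v _ (List.prefix_append _ _) hv
    obtain ⟨is, -, his, h⟩ := hrule v hv'
    exact (ih hv').trans (h.subset (List.mem_map.2 ⟨i, (his i).2 hv, rfl⟩))

/-- Cedents only grow away from the root, so each label contains a formula of `S` and contributes at
least 1 to the size. -/
theorem IsDerivation.card_tree_le {V : Type} {d c : ℕ} {π : LabeledTree V} {S : Cedent V}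
    (hπ : IsDerivation d c π S) (hS : S.Nonempty) : π.tree.card ≤ π.size := by
  rw [Finset.card_eq_sum_ones]
  refine Finset.sum_le_sum fun v hv => ?_
  obtain ⟨φ, hφ⟩ := hS
  exact φ.one_le_size.trans (Finset.single_le_sum (f := fun φ : Formula V => φ.size)
    (fun _ _ => Nat.zero_le _) (hπ.label_subset hv hφ))

/-- The vertex reached from the root along `v`, if `c u` lists the entries of the children
of `u`. -/
def reindex (c : List ℕ → List ℕ) (v : List ℕ) : List ℕ :=
  v.foldl (fun u k => u ++ [(c u).getD (k - 1) 0]) []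

theorem reindex_append (c : List ℕ → List ℕ) (v : List ℕ) (k : ℕ) :
    reindex c (v ++ [k]) = reindex c v ++ [(c (reindex c v)).getD (k - 1) 0] := by
  simp [reindex]

theorem finite_bounded_lists (c N : ℕ) :
    {v : List ℕ | v.length ≤ c ∧ ∀ a ∈ v, a ≤ N}.Finite := by
  refine ((List.finite_length_le (Fin (N + 1)) c).image (List.map Fin.val)).subset ?_
  rintro v ⟨hv, h⟩
  refine ⟨v.pmap (fun a ha => ⟨a, Nat.lt_succ_of_le ha⟩) h, by simpa using hv, ?_⟩
  simp [List.map_pmap]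

/-- The children of a vertex may be numbered with gaps and by arbitrarily large entries. Consecutive
renumbering bounds the entries by the number of vertices, hence by the size. -/
theorem IsDerivation.exists_isNormalProof {n c : ℕ} {π : LabeledTree (Fin (n + 1) × Fin n)}
    (hπ : IsDerivation 2 c π (ontoPHP n)) : ∃ T Γ, IsNormalProof n c π.size T Γ := by
  have hcard := hπ.card_tree_le ⟨_, Finset.mem_insert_self _ _⟩
  obtain ⟨⟨b, hne, hb, hclosed⟩, -, hroot, hrule⟩ := hπ
  choose! is hsort his hrule using hrule
  have hnil : [] ∈ π.tree := by
    obtain ⟨v, hv⟩ := hne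
    exact hclosed _ v (List.nil_prefix) hv
  set e := reindex is with he
  -- The new tree: each entry is an actual child number, so the default value in `reindex` is never
  -- used along its vertices.
  let P : List ℕ → Prop := fun v => ∀ u k, u ++ [k] <+: v → 1 ≤ k ∧ k ≤ (is (e u)).length
  have hP : ∀ v k, P (v ++ [k]) ↔ P v ∧ 1 ≤ k ∧ k ≤ (is (e v)).length := by
    refine fun v k => ⟨fun h => ⟨fun u j hu => h u j (hu.trans (List.prefix_append _ _)),
      h v k List.prefix_rfl⟩, fun h u j hu => ?_⟩
    rcases List.prefix_concat_iff.1 hu with hu | hu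
    · obtain ⟨rfl, hk⟩ := List.append_inj' hu rfl
      obtain rfl : j = k := by simpa using hk
      exact h.2
    · exact h.1 u j hu
  have hmem : ∀ v, P v → e v ∈ π.tree := by
    intro v
    induction v using List.reverseRecOn with
    | nil => exact fun _ => hnil
    | append_singleton v k ih =>
      intro h
      obtain ⟨h, hk, hk'⟩ := (hP v k).1 h
      rw [he, reindex_append, ← he, ← his _ (ih h), List.getD_eq_getElem _ _ (by omega)]
      exact List.getElem_mem _
  have hlen : ∀ v, (e v).length = v.length := by
    intro v
    induction v using List.reverseRecOn with
    | nil => rfl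
    | append_singleton v k ih => rw [he, reindex_append, ← he]; simp [ih]
  have hbound : ∀ v, P v → v.length ≤ c ∧ ∀ a ∈ v, 1 ≤ a ∧ a ≤ π.size := by
    refine fun v hv => ⟨hlen v ▸ (hb _ (hmem v hv)).1, fun a ha => ?_⟩
    obtain ⟨s, t, rfl⟩ := List.append_of_mem ha
    have hpre : s ++ [a] <+: s ++ a :: t := ⟨t, by simp⟩
    obtain ⟨h₁, h₂⟩ := hv s a hpre
    refine ⟨h₁, h₂.trans (le_trans ?_ hcard)⟩
    have hs := hmem s fun u k hu => hv u k (hu.trans (List.prefix_append _ _))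
    rw [← List.toFinset_card_of_nodup ((hsort _ hs).imp fun h => h.ne)]
    refine Finset.card_le_card_of_injOn (fun i => e s ++ [i]) (fun i hi => ?_) fun i _ j _ h => ?_
    · exact (his _ hs i).1 (by simpa using hi)
    · simpa using h
  have hfin : {v | P v}.Finite := (finite_bounded_lists c π.size).subset fun v hv =>
    ⟨(hbound v hv).1, fun a ha => ((hbound v hv).2 a ha).2⟩
  refine ⟨hfin.toFinset, fun v => π.label (e v), ⟨⟨[], ?_⟩, ?_, ?_⟩, hroot, ?_, ?_⟩
  · simp [P]
  · intro v hv
    exact hbound v (by simpa using hv)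
  · intro v w hvw hw
    simp only [Set.Finite.mem_toFinset, Set.mem_ofPred_eq] at hw ⊢
    exact fun u k hu => hw u k (hu.trans hvw)
  · intro v hv
    simp only [Set.Finite.mem_toFinset, Set.mem_ofPred_eq] at hv ⊢
    refine ⟨_, hrule _ (hmem v hv), fun k Δ => ?_⟩
    rw [hP, he, reindex_append, ← he, List.getElem?_map, Option.map_eq_some_iff]
    simp only [List.getElem?_eq_some_iff, Nat.add_sub_cancel]
    constructor
    · rintro ⟨i, ⟨hk, rfl⟩, rfl⟩
      refine ⟨⟨hv, by omega, by omega⟩, ?_⟩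
      rw [List.getD_eq_getElem _ _ hk]
    · rintro ⟨⟨-, -, hk⟩, rfl⟩
      refine ⟨_, ⟨hk, rfl⟩, ?_⟩
      rw [List.getD_eq_getElem _ _ hk]
  · intro v hv φ hφ
    exact π.formula_size_le (hmem v (by simpa using hv)) hφ

namespace IsNormalProof

variable {n c z t : ℕ} {T : Finset (List ℕ)} {Γ : List ℕ → Cedent (Fin (n + 1) × Fin n)}

theorem nil_mem (h : IsNormalProof n c z T Γ) : [] ∈ T := by
  obtain ⟨v, hv⟩ := h.rooted.1
  exact h.rooted.2.2 _ v List.nil_prefix hv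

theorem mem_of_prefix (h : IsNormalProof n c z T Γ) {v w : List ℕ} (hvw : v <+: w) (hw : w ∈ T) :
    v ∈ T :=
  h.rooted.2.2 v w hvw hw

theorem bounds_of_append_mem (h : IsNormalProof n c z T Γ) {v : List ℕ} {k : ℕ}
    (hv : v ++ [k] ∈ T) : 1 ≤ k ∧ k ≤ z :=
  (h.rooted.2.1 _ hv).2 k (by simp)

theorem exists_premise (h : IsNormalProof n c z T Γ) {v : List ℕ} {k : ℕ} (hv : v ++ [k] ∈ T) :
    ∃ Δs, Rule 2 z (Γ v) Δs ∧ Δs[k - 1]? = some (Γ (v ++ [k])) ∧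
      ∀ k Δ, Δs[k]? = some Δ ↔ v ++ [k + 1] ∈ T ∧ Γ (v ++ [k + 1]) = Δ := by
  have hk := (h.bounds_of_append_mem hv).1
  obtain ⟨Δs, hΔs, hΔ⟩ := h.rule v (h.mem_of_prefix (List.prefix_append _ _) hv)
  refine ⟨Δs, hΔs, (hΔ _ _).2 ?_, hΔ⟩
  rw [Nat.sub_add_cancel hk]
  exact ⟨hv, rfl⟩

theorem isShallow (h : IsNormalProof n c z T Γ) (ht : 2 ≤ t) (hz : Nat.log 2 z ≤ t)
    {v : List ℕ} (hv : v ∈ T) : ∀ φ ∈ Γ v, φ.IsShallow t := by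
  induction v using List.reverseRecOn with
  | nil => rw [h.root]; exact fun φ => isShallow_of_mem_ontoPHP ht
  | append_singleton v k ih =>
    obtain ⟨Δs, hΔs, hk, -⟩ := h.exists_premise hv
    exact hΔs.isShallow hz (ih (h.mem_of_prefix (List.prefix_append _ _) hv))
      (List.mem_of_getElem? hk)

theorem sibling_mem (h : IsNormalProof n c z T Γ) {v : List ℕ} {k l : ℕ} (hv : v ++ [k] ∈ T)
    (hl : 1 ≤ l) (hlk : l ≤ k) : v ++ [l] ∈ T := by
  obtain ⟨Δs, hΔs, hk, hΔ⟩ := h.exists_premise hv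
  have hlen : l - 1 < Δs.length := lt_of_le_of_lt (by omega) (List.getElem?_eq_some_iff.1 hk).1
  have := ((hΔ (l - 1) _).1 (List.getElem?_eq_getElem hlen)).1
  rwa [Nat.sub_add_cancel hl] at this

end IsNormalProof

/-- `φ` occurs at the vertex `x ++ [k]`, but not at `x`. -/
def IsNew {V : Type} (Γ : List ℕ → Cedent V) (x : List ℕ) (k : ℕ) (φ : Formula V) : Prop :=
  φ ∈ Γ (x ++ [k]) ∧ φ ∉ Γ x

/-- Assigns a formula outside the root cedent to an edge of the branch where it enters; the entry of
`A` for that edge can then store its evidence. -/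
theorem mem_root_or_isNew {V : Type} {Γ : List ℕ → Cedent V} {v : List ℕ} {φ : Formula V}
    (h : φ ∈ Γ v) : φ ∈ Γ [] ∨ ∃ x k, x ++ [k] <+: v ∧ IsNew Γ x k φ := by
  induction v using List.reverseRecOn with
  | nil => exact .inl h
  | append_singleton v k ih =>
    by_cases hv : φ ∈ Γ v
    · refine (ih hv).imp_right ?_
      rintro ⟨x, j, hx, hn⟩
      exact ⟨x, j, hx.trans (List.prefix_append _ _), hn⟩
    · exact .inr ⟨v, k, List.prefix_rfl, h, hv⟩

theorem IsNormalProof.next {n c z t : ℕ} {T : Finset (List ℕ)}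
    {Γ : List ℕ → Cedent (Fin (n + 1) × Fin n)} (h : IsNormalProof n c z T Γ) (ht : 2 ≤ t)
    (hz : Nat.log 2 z ≤ t) {x : List ℕ} {k : ℕ} (hx : x ++ [k] ∈ T) {I : ℕ}
    {φ : Fin I → Formula (Fin (n + 1) × Fin n)} (hφ : IsNew Γ x k (.bigOr I φ)) (i : Fin I)
    (hi : ¬ (φ i).IsFlat) :
    x ++ [k + 1] ∈ T ∧ ∀ ψ, IsNew Γ x (k + 1) ψ → ψ = (Formula.bigOr I φ).compl ∨
      ∃ J χ, ψ = .bigOr J χ ∧ ∀ j, ¬ (χ j).IsFlat := by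
  obtain ⟨Δs, hΔs, hk, hΔ⟩ := h.exists_premise hx
  have hk1 := (h.bounds_of_append_mem hx).1
  obtain ⟨Δ', h₁, h₂⟩ := hΔs.next_premise hz
    (h.isShallow ht hz (h.mem_of_prefix (List.prefix_append _ _) hx)) hk hφ.1 hφ.2 i hi
  rw [Nat.sub_add_cancel hk1, hΔ] at h₁
  obtain ⟨h₁, rfl⟩ := h₁
  exact ⟨h₁, fun ψ hψ => (h₂ ψ hψ.1).resolve_left hψ.2⟩

/-! ### Evidence for the falsity of a cedent -/

/-- The matching `M` and the sequence `A` witness that all formulas at `v` are false, except for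
disjunctions, which are treated as universal claims. -/
structure Evidence {n : ℕ} (Γ : List ℕ → Cedent (Fin (n + 1) × Fin n)) (v : List ℕ)
    (M : EdgeSet n) (A : List ℕ) : Prop where
  flat : ∀ φ ∈ Γ v, φ.IsFlat → φ.Falsified M
  bigAnd : ∀ x k I χ, x ++ [k] <+: v → IsNew Γ x k (.bigAnd I χ) →
    ∃ i : Fin I, A[x.length]? = some (i.1 + 1) ∧ ((χ i).IsFlat → (χ i).Falsified M)
  bigOr : ∀ x k I χ (j : Fin I), x ++ [k] <+: v → IsNew Γ x k (.bigOr I χ) → (χ j).IsFlat →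
    ∃ y m J ψ, ∃ i : Fin J, y ++ [m] <+: x ∧ IsNew Γ y m (.bigAnd J ψ) ∧
      A[y.length]? = some (i.1 + 1) ∧ ψ i = .bigOr I χ

theorem length_lt_of_append_prefix {x v : List ℕ} {k : ℕ} (h : x ++ [k] <+: v) :
    x.length < v.length := by
  have := h.length_le
  simp at this
  omega

section

variable {n c z t : ℕ} {T : Finset (List ℕ)} {Γ : List ℕ → Cedent (Fin (n + 1) × Fin n)}
  {v : List ℕ} {M N M' : EdgeSet n} {A : List ℕ}

/-- Old evidence refers to entries of `A` at heights below that of `v` and to a matching that only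
grows, so only the formulas new at the child need attention. -/
theorem Evidence.append (h : Evidence Γ v M A) (hA : A.length = v.length) (hMN : M ⊆ N)
    {y B : ℕ} (h₀ : ∀ φ, IsNew Γ v y φ → φ.IsFlat → φ.Falsified N)
    (h₁ : ∀ I χ, IsNew Γ v y (.bigAnd I χ) →
      ∃ i : Fin I, B = i.1 + 1 ∧ ((χ i).IsFlat → (χ i).Falsified N))
    (h₂ : ∀ I χ (j : Fin I), IsNew Γ v y (.bigOr I χ) → (χ j).IsFlat →
      ∃ x m J ψ, ∃ i : Fin J, x ++ [m] <+: v ∧ IsNew Γ x m (.bigAnd J ψ) ∧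
        A[x.length]? = some (i.1 + 1) ∧ ψ i = .bigOr I χ) :
    Evidence Γ (v ++ [y]) N (A ++ [B]) := by
  have old : ∀ x : List ℕ, x.length < v.length → (A ++ [B])[x.length]? = A[x.length]? :=
    fun x hx => List.getElem?_append_left (by omega)
  have split : ∀ x k, x ++ [k] <+: v ++ [y] → (x = v ∧ k = y) ∨ x ++ [k] <+: v := by
    intro x k hx
    refine (List.prefix_concat_iff.1 hx).imp_left fun hx => ?_
    obtain ⟨rfl, hk⟩ := List.append_inj' hx rfl
    exact ⟨rfl, by simpa using hk⟩
  refine ⟨fun φ hφ hf => ?_, fun x k I χ hx hn => ?_, fun x k I χ j hx hn hf => ?_⟩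
  · by_cases hv : φ ∈ Γ v
    · exact (h.flat φ hv hf).mono hMN
    · exact h₀ φ ⟨hφ, hv⟩ hf
  · rcases split x k hx with ⟨rfl, rfl⟩ | hx
    · obtain ⟨i, rfl, hi⟩ := h₁ I χ hn
      refine ⟨i, ?_, hi⟩
      rw [← hA]; simp
    · obtain ⟨i, hi, hf⟩ := h.bigAnd x k I χ hx hn
      refine ⟨i, ?_, fun h => (hf h).mono hMN⟩
      rw [old x (length_lt_of_append_prefix hx), hi]
  · rcases split x k hx with ⟨rfl, rfl⟩ | hx
    · obtain ⟨x', m, J, ψ, i, hx', hn', hi, e⟩ := h₂ I χ j hn hf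
      refine ⟨x', m, J, ψ, i, hx', hn', ?_, e⟩
      rw [old x' (length_lt_of_append_prefix hx'), hi]
    · obtain ⟨y', m, J, ψ, i, hy', hn', hi, e⟩ := h.bigOr x k I χ j hx hn hf
      refine ⟨y', m, J, ψ, i, hy', hn', ?_, e⟩
      rw [old y' ((length_lt_of_append_prefix hy').trans (length_lt_of_append_prefix hx)), hi]

/-! ### Good moves -/

/-- The moves of Prover that preserve evidence. -/
inductive GoodMove (T : Finset (List ℕ)) (Γ : List ℕ → Cedent (Fin (n + 1) × Fin n))
    (v : List ℕ) (M : EdgeSet n) (A : List ℕ) (M' : EdgeSet n) : Move → Prop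
  | climb (y B : ℕ) (hT : v ++ [y] ∈ T) (he : Evidence Γ (v ++ [y]) (M ∪ M') (A ++ [B]))
      (hflat : ∀ I χ (i : Fin I), IsNew Γ v y (.bigAnd I χ) → (χ i).IsFlat) :
      GoodMove T Γ v M A M' (.climb y B)
  | advance (x σ : List ℕ) (k B : ℕ) (hv : v = x ++ [k] ++ σ) (hT : x ++ [k + 1] ∈ T)
      (he : ∀ M₀ A₀, A₀.length = x.length → Evidence Γ x M₀ A₀ →
        Evidence Γ (x ++ [k + 1]) (M₀ ∪ M') (A₀ ++ [B]))
      (hT' : v ++ [1] ∈ T)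
      (hleft : ∀ I χ (i : Fin I), IsNew Γ x (k + 1) (.bigAnd I χ) → B = i.1 + 1 →
        Γ (v ++ [1]) = insert (χ i).compl (Γ v)) :
      GoodMove T Γ v M A M' (.advance x B)
  | backtrack (x σ : List ℕ) (k : ℕ) (hv : v = x ++ [k] ++ σ) (I : ℕ)
      (χ : Fin I → Formula (Fin (n + 1) × Fin n)) (i : Fin I)
      (hn : IsNew Γ x k (.bigAnd I χ)) (hA : A[x.length]? = some (i.1 + 1)) (J : ℕ)
      (ψ : Fin J → Formula (Fin (n + 1) × Fin n)) (hχ : χ i = .bigOr J ψ) (j : Fin J)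
      (hψ : ∀ j, (ψ j).IsFlat) (hf : (ψ j).compl.Falsified M') :
      GoodMove T Γ v M A M' (.backtrack x (j.1 + 1))

theorem GoodMove.climb_of_insert (he : Evidence Γ v M A) (hA : A.length = v.length) {y B : ℕ}
    (hT : v ++ [y] ∈ T) {ψ : Formula (Fin (n + 1) × Fin n)} (hψ : Γ (v ++ [y]) = insert ψ (Γ v))
    (h₀ : ψ.IsFlat → ψ.Falsified (M ∪ M'))
    (h₁ : ∀ I χ, ψ = .bigAnd I χ → (∀ i, (χ i).IsFlat) ∧
      ∃ i : Fin I, B = i.1 + 1 ∧ (χ i).Falsified (M ∪ M'))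
    (h₂ : ∀ I χ (j : Fin I), ψ = .bigOr I χ → (χ j).IsFlat →
      ∃ x m J ψ, ∃ i : Fin J, x ++ [m] <+: v ∧ IsNew Γ x m (.bigAnd J ψ) ∧
        A[x.length]? = some (i.1 + 1) ∧ ψ i = .bigOr I χ) :
    GoodMove T Γ v M A M' (.climb y B) := by
  have hnew : ∀ φ, IsNew Γ v y φ → φ = ψ := by
    rintro φ ⟨h, h'⟩
    rw [hψ] at h
    exact (Finset.mem_insert.1 h).resolve_right h'
  refine .climb y B hT (he.append hA Finset.subset_union_left ?_ ?_ ?_) ?_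
  · intro φ hφ hf
    rw [hnew φ hφ] at hf ⊢
    exact h₀ hf
  · intro I χ hn
    obtain ⟨-, i, hi, hf⟩ := h₁ I χ (hnew _ hn).symm
    exact ⟨i, hi, fun _ => hf⟩
  · intro I χ j hn hf
    exact h₂ I χ j (hnew _ hn).symm hf
  · intro I χ i hn
    exact (h₁ I χ (hnew _ hn).symm).1 i

theorem GoodMove.climb_flat (he : Evidence Γ v M A) (hA : A.length = v.length) {y : ℕ} (B : ℕ)
    (hT : v ++ [y] ∈ T) {ψ : Formula (Fin (n + 1) × Fin n)} (hψ : Γ (v ++ [y]) = insert ψ (Γ v))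
    (hf : ψ.IsFlat) (h₀ : ψ.Falsified (M ∪ M')) : GoodMove T Γ v M A M' (.climb y B) := by
  refine .climb_of_insert he hA hT hψ (fun _ => h₀) ?_ ?_
  · rintro I χ rfl
    exact hf.elim
  · rintro I χ _ rfl
    exact hf.elim

/-! ### Queries and Delayer's answers -/

/-- A query for every axiom instance of the pigeonhole principle that refutes it. -/
theorem exists_query_of_mem_ontoPHP {I : ℕ} {φ : Fin I → Formula (Fin (n + 1) × Fin n)}
    (h : .bigOr I φ ∈ ontoPHP n) (i : Fin I) :
    ∃ Q : Query n, Q.card ≤ 2 ∧ ∀ M, Covers M Q → ((φ i).IsFlat ∧ (φ i).Falsified M) ∨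
      ∃ J χ, ∃ j : Fin J, φ i = .bigAnd J χ ∧ (∀ j, (χ j).IsFlat) ∧ (χ j).Falsified M := by
  simp only [ontoPHP, Finset.mem_insert, Finset.mem_singleton, Formula.disj] at h
  rcases h with h | h | h | h
  · cases h
    refine ⟨{.inl i}, by simp, fun M hM => .inr ?_⟩
    obtain ⟨h, hh⟩ := hM.1 i (by simp)
    exact ⟨_, _, h, rfl, fun _ => trivial, hh⟩
  · cases h
    have hne := List.get_mem (distinctTriples (n + 1) n) i
    simp only [distinctTriples, List.mem_filter, decide_eq_true_eq] at hne
    replace hne := hne.2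
    refine ⟨{.inl ((distinctTriples (n + 1) n).get i).1,
      .inl ((distinctTriples (n + 1) n).get i).2.1}, Finset.card_le_two, fun M hM => .inl ?_⟩
    refine ⟨⟨trivial, trivial⟩, ?_⟩
    obtain ⟨h, hh⟩ := hM.1 ((distinctTriples (n + 1) n).get i).1 (by simp)
    -- The place of the first pigeon decides: if it occupies the hole in question, the second
    -- variable is false.
    by_cases hx : h = ((distinctTriples (n + 1) n).get i).2.2
    · exact .inr ⟨_, hh, .inr ⟨hne, hx⟩⟩
    · exact .inl ⟨_, hh, .inl ⟨rfl, hx⟩⟩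
  · cases h
    refine ⟨{.inr i}, by simp, fun M hM => .inr ?_⟩
    obtain ⟨p, hp⟩ := hM.2 i (by simp)
    exact ⟨_, _, p, rfl, fun _ => trivial, hp⟩
  · cases h
    have hne := List.get_mem (distinctTriples n (n + 1)) i
    simp only [distinctTriples, List.mem_filter, decide_eq_true_eq] at hne
    replace hne := hne.2
    refine ⟨{.inl ((distinctTriples n (n + 1)).get i).2.2}, by simp, fun M hM => .inl ?_⟩
    refine ⟨⟨trivial, trivial⟩, ?_⟩
    obtain ⟨h, hh⟩ := hM.1 ((distinctTriples n (n + 1)).get i).2.2 (by simp)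
    by_cases hx : h = ((distinctTriples n (n + 1)).get i).1
    · exact .inr ⟨_, hh, .inl ⟨rfl, fun e => hne (hx.symm.trans e)⟩⟩
    · exact .inl ⟨_, hh, .inl ⟨rfl, hx⟩⟩

theorem IsMinimalCover.covers {Q : Query n} (h : IsMinimalCover Q M) : Covers M Q :=
  h.prop.2

theorem IsMatching.subset (hN : IsMatching N) (h : M ⊆ N) : IsMatching M :=
  fun e he e' he' => hN e (h he) e' (h he')

/-- One chosen edge for each element of `Q` already gives a covering submatching, which by
minimality is all of `M`. -/
theorem IsMinimalCover.card_le {Q : Query n} (h : IsMinimalCover Q M) : M.card ≤ Q.card := by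
  have hq : ∀ q ∈ Q, ∃ e ∈ M, q = .inl e.1 ∨ q = .inr e.2 := by
    rintro (p | y) hq
    · obtain ⟨y, hy⟩ := h.covers.1 p hq
      exact ⟨_, hy, .inl rfl⟩
    · obtain ⟨p, hp⟩ := h.covers.2 y hq
      exact ⟨_, hp, .inr rfl⟩
  choose f hf hfq using hq
  let N : EdgeSet n := Q.attach.image fun q => f q.1 q.2
  have hN : N ⊆ M := by
    intro e he
    obtain ⟨q, -, rfl⟩ := Finset.mem_image.1 he
    exact hf _ _
  have hmem : ∀ q (hq : q ∈ Q), f q hq ∈ N := fun q hq =>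
    Finset.mem_image.2 ⟨⟨q, hq⟩, Finset.mem_attach _ _, rfl⟩
  have hcov : Covers N Q := by
    refine ⟨fun p hp => ⟨(f _ hp).2, ?_⟩, fun y hy => ⟨(f _ hy).1, ?_⟩⟩
    · have : p = (f _ hp).1 := by simpa using hfq _ hp
      have hm := hmem _ hp
      rwa [show f _ hp = (p, (f _ hp).2) from Prod.ext this.symm rfl] at hm
    · have : y = (f _ hy).2 := by simpa using hfq _ hy
      have hm := hmem _ hy
      rwa [show f _ hy = ((f _ hy).1, y) from Prod.ext rfl this.symm] at hm
  have := h.le_of_le ⟨h.prop.1.subset hN, hcov⟩ hN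
  calc M.card ≤ N.card := Finset.card_le_card this
    _ ≤ Q.attach.card := Finset.card_image_le
    _ = Q.card := Finset.card_attach

end

/-! ### Finding a good move from the frontier -/

theorem Formula.IsShallow.isFlat_of_bigOr {n t I : ℕ}
    {φ : Fin I → Formula (Fin (n + 1) × Fin n)} (h : IsShallow t (bigOr I φ)) {i : Fin I}
    (hi : (φ i).IsFlat) (j : Fin I) : (φ j).IsFlat := by
  cases h with
  | small _ h => exact h.1.elim
  | or _ _ h => exact (h j).1
  | orAnd _ _ _ h => exact hi.elim

/-- Case analysis on the rule applied at `v`. Only the `⋁`-rule calls for a nonempty query or for a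
move other than a climb. -/
theorem exists_query_goodMove {n c C z : ℕ} {T : Finset (List ℕ)}
    {Γ : List ℕ → Cedent (Fin (n + 1) × Fin n)} {v : List ℕ} {M : EdgeSet n} {A : List ℕ}
    (h : IsNormalProof n c z T Γ) (ht : 2 ≤ binLen n ^ C) (hz : z ≤ 2 ^ binLen n ^ C)
    (hv : v ∈ T) (hM : IsMatching M) (hA : A.length = v.length) (he : Evidence Γ v M A) :
    ∃ Q : Query n, Q.card ≤ binLen n ^ C ∧ ∀ M', IsMinimalCover Q M' →
      ∃ mv : Move, mv.IsLegal n C v ∧ GoodMove T Γ v M A M' mv := by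
  have hlog : Nat.log 2 z ≤ binLen n ^ C := by
    have := Nat.log_mono_right (b := 2) hz
    rwa [Nat.log_pow Nat.one_lt_two] at this
  have hshallow := h.isShallow ht hlog hv
  have hone : 1 ≤ 2 ^ binLen n ^ C := Nat.one_le_two_pow
  have hclimb : ∀ y B, v ++ [y] ∈ T → 1 ≤ B → B ≤ 2 ^ binLen n ^ C →
      (Move.climb y B).IsLegal n C v := fun y B hy h₁ h₂ =>
    ⟨⟨(h.bounds_of_append_mem hy).1, (h.bounds_of_append_mem hy).2.trans hz⟩, h₁, h₂⟩
  have hproper : ∀ (x σ : List ℕ) (k : ℕ), x ++ [k] ++ σ = v → x <+: v ∧ x ≠ v := by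
    rintro x σ k rfl
    exact ⟨⟨[k] ++ σ, by simp⟩, fun e => by simpa using congrArg List.length e⟩
  have simple : ∀ y ψ, v ++ [y] ∈ T → Γ (v ++ [y]) = insert ψ (Γ v) → ψ.IsFlat →
      ψ.Falsified M → ∃ Q : Query n, Q.card ≤ binLen n ^ C ∧ ∀ M', IsMinimalCover Q M' →
        ∃ mv : Move, mv.IsLegal n C v ∧ GoodMove T Γ v M A M' mv :=
    fun y ψ hy hψ hf hF => ⟨∅, by simp, fun M' _ => ⟨.climb y 1, hclimb _ _ hy le_rfl hone,
      .climb_flat he hA 1 hy hψ hf (hF.mono Finset.subset_union_left)⟩⟩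
  obtain ⟨Δs, hr, hΔ⟩ := h.rule v hv
  have child : ∀ k Δ, Δs[k]? = some Δ → v ++ [k + 1] ∈ T ∧ Γ (v ++ [k + 1]) = Δ :=
    fun k Δ => (hΔ k Δ).1
  clear hΔ
  generalize hG : Γ v = G at hr
  cases hr
  case initConst b h₁ h₂ =>
    subst hG
    have e₁ : b = false := he.flat _ h₁ trivial
    have e₂ : (!b) = false := he.flat _ h₂ trivial
    simp [e₁] at e₂
  case initVar x h₁ h₂ =>
    subst hG
    obtain ⟨e, heM, hx⟩ := he.flat _ h₁ trivial
    have hxM : x ∈ M := he.flat _ h₂ trivial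
    -- The edge `e` shares exactly one end with `x`, impossible inside a matching.
    have := hM e heM x hxM
    tauto
  case bigOr I φ i₀ hm hn =>
    subst hG
    obtain ⟨hT₁, hΓ₁⟩ := child 0 _ rfl
    rw [zero_add] at hT₁ hΓ₁
    by_cases hroot : .bigOr I φ ∈ Γ []
    · rw [h.root] at hroot
      obtain ⟨Q, hQ, hcov⟩ := exists_query_of_mem_ontoPHP hroot i₀
      refine ⟨Q, hQ.trans ht, fun M' hM' => ?_⟩
      rcases hcov M' hM'.covers with ⟨hf, hF⟩ | ⟨J, χ, j, e, hfl, hF⟩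
      · exact ⟨.climb 1 1, hclimb _ _ hT₁ le_rfl hone,
          .climb_flat he hA 1 hT₁ hΓ₁ hf (hF.mono Finset.subset_union_right)⟩
      · rw [e] at hΓ₁
        have hJ := (Formula.le_size_bigAnd χ).trans
          (h.size_le _ hT₁ _ (hΓ₁ ▸ Finset.mem_insert_self _ _))
        refine ⟨.climb 1 (j.1 + 1), hclimb _ _ hT₁ (by omega) (by omega),
          .climb_of_insert he hA hT₁ hΓ₁ (fun hf => hf.elim) ?_ ?_⟩
        · intro I' χ' e'
          cases e'
          exact ⟨hfl, j, rfl, hF.mono Finset.subset_union_right⟩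
        · intro I' χ' _ e'
          cases e'
    · have hI := (Formula.le_size_bigOr φ).trans (h.size_le _ hv _ hm)
      obtain ⟨w, k, hw, hnew⟩ := (mem_root_or_isNew hm).resolve_left hroot
      rcases (hshallow _ hm).of_bigOr i₀ with hs | ⟨J, χ, e, hs⟩
      -- Flat disjuncts: the disjunction is the recorded conjunct of a conjunction that entered at
      -- `x ++ [m]`, and that record is what a true disjunct refutes.
      · obtain ⟨x, m, J, ψ, i, hx, hn', hi, e⟩ := he.bigOr w k I φ i₀ hw hnew hs.1
        refine ⟨(φ i₀).pigeons.image Sum.inl, Finset.card_image_le.trans hs.2,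
          fun M' hM' => ?_⟩
        -- The answer `M'` decides the disjunct without `M`; this matters because `M` is lost on
        -- backtracking.
        rcases Formula.falsified_or_falsified_compl hs.1
          fun p hp => hM'.covers.1 p (Finset.mem_image_of_mem _ hp) with hF | hF
        · exact ⟨.climb 1 1, hclimb _ _ hT₁ le_rfl hone,
            .climb_flat he hA 1 hT₁ hΓ₁ hs.1 (hF.mono Finset.subset_union_right)⟩
        · obtain ⟨σ, hσ⟩ := (hx.trans (List.prefix_append w [k])).trans hw
          exact ⟨.backtrack x (i₀.1 + 1), ⟨hproper _ _ _ hσ, by omega, by omega⟩,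
            .backtrack x σ m hσ.symm J ψ i hn' hi I φ e i₀
              ((hshallow _ hm).isFlat_of_bigOr hs.1) hF⟩
      -- The picked disjunct is a conjunction without known counterexample: advance, recording its
      -- complement as the false conjunct of the complemented induction formula.
      · have hnf : ¬ (φ i₀).IsFlat := by rw [e]; exact fun h => h
        obtain ⟨hT₂, hnext⟩ := h.next ht hlog (h.mem_of_prefix hw hv) hnew i₀ hnf
        obtain ⟨σ, hσ⟩ := hw
        refine ⟨∅, by simp, fun M' _ => ⟨.advance w (i₀.1 + 1),
          ⟨hproper _ _ _ hσ, by omega, by omega⟩, .advance w σ k _ hσ.symm hT₂ ?_ hT₁ ?_⟩⟩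
        · intro M₀ A₀ hA₀ he₀
          refine he₀.append hA₀ Finset.subset_union_left ?_ ?_ ?_
          · intro ψ hψ hf
            rcases hnext ψ hψ with rfl | ⟨J, χ, rfl, -⟩ <;> exact hf.elim
          · intro I' χ' hψ
            rcases hnext _ hψ with e' | ⟨J, χ, e', -⟩ <;> cases e'
            exact ⟨i₀, rfl, fun hf => (hnf ((Formula.isFlat_compl _).1 hf)).elim⟩
          · intro I' χ' j hψ hf
            rcases hnext _ hψ with e' | ⟨J, χ, e', hχ⟩ <;> cases e'
            exact (hχ j hf).elim
        · intro I' χ' i hψ hi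
          rcases hnext _ hψ with e' | ⟨J, χ, e', -⟩ <;> cases e'
          obtain rfl : i₀ = i := Fin.ext (by omega)
          rw [Formula.compl_compl, hΓ₁]
  case orLeft φ ψ hm hn =>
    subst hG
    obtain ⟨hT₁, hΓ₁⟩ := child 0 _ rfl
    have hs := (hshallow _ hm).of_or
    exact simple _ _ hT₁ hΓ₁ hs.1.1 (he.flat _ hm ⟨hs.1.1, hs.2.1⟩).1
  case orRight φ ψ hm hn =>
    subst hG
    obtain ⟨hT₁, hΓ₁⟩ := child 0 _ rfl
    have hs := (hshallow _ hm).of_or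
    exact simple _ _ hT₁ hΓ₁ hs.2.1 (he.flat _ hm ⟨hs.1.1, hs.2.1⟩).2
  case bigAnd I φ hm hn =>
    subst hG
    have hroot : .bigAnd I φ ∉ Γ [] := by
      rw [h.root]
      intro h
      obtain ⟨_, _, e⟩ := exists_bigOr_of_mem_ontoPHP h
      cases e
    obtain ⟨x, k, hx, hnew⟩ := (mem_root_or_isNew hm).resolve_left hroot
    -- The recorded index selects the premise to climb to.
    obtain ⟨i, hi, hF⟩ := he.bigAnd x k I φ hx hnew
    obtain ⟨hT₁, hΓ₁⟩ := child i (insert (φ i) (Γ v)) (by simp)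
    rcases (hshallow _ hm).of_bigAnd i with hs | ⟨J, χ, e, hs⟩
    · exact simple _ _ hT₁ hΓ₁ hs.1 (hF hs.1)
    · refine ⟨∅, by simp, fun M' _ => ⟨.climb (i.1 + 1) 1, hclimb _ _ hT₁ le_rfl hone,
        .climb_of_insert he hA hT₁ hΓ₁ ?_ ?_ ?_⟩⟩
      · rw [e]; exact fun h => h.elim
      · rw [e]; intro _ _ e'; cases e'
      · intro I' χ' j e' _
        exact ⟨x, k, I, φ, i, hx, hnew, hi, e'⟩
  case and φ ψ hm h₁ h₂ =>
    subst hG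
    have hs := (hshallow _ hm).of_and
    rcases he.flat _ hm ⟨hs.1.1, hs.2.1⟩ with hF | hF
    · obtain ⟨hT₁, hΓ₁⟩ := child 0 _ rfl
      exact simple _ _ hT₁ hΓ₁ hs.1.1 hF
    · obtain ⟨hT₁, hΓ₁⟩ := child 1 _ rfl
      exact simple _ _ hT₁ hΓ₁ hs.2.1 hF
  case trivialCut hn =>
    subst hG
    obtain ⟨hT₁, hΓ₁⟩ := child 0 _ rfl
    exact simple _ _ hT₁ hΓ₁ trivial rfl
  case induction m φ hφ hn =>
    subst hG
    obtain ⟨hT₁, hΓ₁⟩ := child 0 _ rfl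
    -- The first premise adds a disjunction of conjunctions, whose falsity needs no evidence.
    obtain ⟨I, J, χ, e, -⟩ := (hφ 0 (Nat.zero_le _)).exists_orAnd hlog
    refine ⟨∅, by simp, fun M' _ => ⟨.climb _ 1, hclimb _ _ hT₁ le_rfl hone,
      .climb_of_insert he hA hT₁ hΓ₁ ?_ ?_ ?_⟩⟩
    · rw [e]; exact fun h => h.elim
    · rw [e]; intro _ _ e'; cases e'
    · rw [e]
      intro I' χ' j e' hf
      cases e'
      exact hf.elim

/-! ### The invariant of the play -/

/-- All labels carry evidence, and whenever a vertex claims a counterexample to a conjunction of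
disjunctions, the subtree to the left contains the vertex that can react to a challenge. -/
structure GameInvariant (n C : ℕ) (T : Finset (List ℕ))
    (Γ : List ℕ → Cedent (Fin (n + 1) × Fin n)) (L : Labeling n) : Prop where
  pos : IsPosition n C T L
  evidence : ∀ v M A, L v = some (M, A) → Evidence Γ v M A
  left : ∀ x k M A I χ, ∀ i : Fin I, L (x ++ [k]) = some (M, A) → IsNew Γ x k (.bigAnd I χ) →
    A[x.length]? = some (i.1 + 1) → ¬ (χ i).IsFlat →
    ∃ k' l, k = k' + 1 ∧ IsGreatest {w ∈ L.dom | x ++ [k'] <+: w} l ∧ l ++ [1] ∈ T ∧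
      Γ (l ++ [1]) = insert (χ i).compl (Γ l)

section

variable {n c C z : ℕ} {T : Finset (List ℕ)} {Γ : List ℕ → Cedent (Fin (n + 1) × Fin n)}

theorem Labeling.mem_dom {L : Labeling n} {v : List ℕ} {p : EdgeSet n × List ℕ}
    (h : L v = some p) : v ∈ L.dom := by
  simp [Labeling.dom, h]

theorem Labeling.exists_of_mem_dom {L : Labeling n} {v : List ℕ} (h : v ∈ L.dom) :
    ∃ M A, L v = some (M, A) := by
  obtain ⟨⟨M, A⟩, h⟩ := Option.ne_none_iff_exists'.1 h
  exact ⟨M, A, h⟩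

/-! ### Progress measure and a single step -/

open Classical in
/-- The domain of a position, as an element of the colexicographic order of the sets of vertices
with respect to the reversed order of the vertices. -/
noncomputable def domKey (T : Finset (List ℕ)) (L : Labeling n) : Colex (Finset (List ℕ)ᵒᵈ) :=
  toColex ((T.filter (· ∈ L.dom)).map OrderDual.toDual.toEmbedding)

/-- All deleted vertices exceed `a`, so the least vertex at which the two domains, cut down to `T`,
differ belongs to the new one. -/
theorem domKey_lt {L L' : Labeling n} {a : List ℕ} (haT : a ∈ T) (ha : a ∉ L.dom)
    (ha' : a ∈ L'.dom) (h : ∀ w ∈ L.dom, w ∉ L'.dom → a < w) : domKey T L < domKey T L' := by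
  classical
  rw [domKey, domKey, Finset.Colex.toColex_lt_toColex_iff_exists_forall_lt]
  refine ⟨OrderDual.toDual a, by simp [haT, ha'], by simp [ha], ?_⟩
  intro b hb hb'
  obtain ⟨w, rfl⟩ := OrderDual.toDual.surjective b
  simp at hb hb'
  exact OrderDual.toDual_lt_toDual.2 (h w hb.2 (hb' hb.1))

theorem IsPosition.exists_isGreatest {L : Labeling n} (h : IsPosition n C T L) :
    ∃ v, IsGreatest L.dom v := by
  classical
  have hne : (T.filter (· ∈ L.dom)).Nonempty :=
    ⟨[], Finset.mem_filter.2 ⟨h.dom_subset _ h.root_mem, h.root_mem⟩⟩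
  refine ⟨_, (Finset.mem_filter.1 (Finset.max'_mem _ hne)).2, fun w hw => ?_⟩
  exact Finset.le_max' _ _ (Finset.mem_filter.2 ⟨h.dom_subset _ hw, hw⟩)

/-- Common core of the three moves: `L₀` is what remains of `L` after deletions, and `u` is the
vertex whose label is extended. For climbing and advancing, `L₀ = L`. -/
theorem GameInvariant.step {L L₀ : Labeling n} (hL : GameInvariant n C T Γ L)
    (h₀ : ∀ w, L₀ w = none ∨ L₀ w = L w)
    (hcl : ∀ v w, v <+: w → w ∈ L₀.dom → v ∈ L₀.dom) {u : List ℕ} {j B : ℕ}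
    {M M' : EdgeSet n} {A : List ℕ} (hu : L₀ u = some (M, A)) (hT : u ++ [j] ∈ T)
    (hmax : ∀ w ∈ L₀.dom, w < u ++ [j]) (hdel : ∀ w ∈ L.dom, w ∉ L₀.dom → u ++ [j] < w)
    (hM : IsMatching (M ∪ M')) (hM' : M'.card ≤ binLen n ^ C)
    (hB : 1 ≤ B ∧ B ≤ 2 ^ binLen n ^ C)
    (he : Evidence Γ (u ++ [j]) (M ∪ M') (A ++ [B]))
    (hleft : ∀ I χ, ∀ i : Fin I, IsNew Γ u j (.bigAnd I χ) → B = i.1 + 1 → ¬ (χ i).IsFlat →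
      ∃ k' l, j = k' + 1 ∧ IsGreatest {w ∈ L.dom | u ++ [k'] <+: w} l ∧ l ++ [1] ∈ T ∧
        Γ (l ++ [1]) = insert (χ i).compl (Γ l)) :
    GameInvariant n C T Γ (Function.update L₀ (u ++ [j]) (some (M ∪ M', A ++ [B]))) ∧
      domKey T L < domKey T (Function.update L₀ (u ++ [j]) (some (M ∪ M', A ++ [B]))) := by
  set a := u ++ [j] with ha
  set L' : Labeling n := Function.update L₀ a (some (M ∪ M', A ++ [B])) with hL'
  have hL'a : L' a = some (M ∪ M', A ++ [B]) := by simp [hL']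
  have hL'w : ∀ w, w ≠ a → L' w = L₀ w := fun w hw => by simp [hL', hw]
  have ha₀ : a ∉ L₀.dom := fun h => lt_irrefl _ (hmax a h)
  have hsub : ∀ w p, L₀ w = some p → L w = some p := by
    intro w p hw
    rcases h₀ w with h | h
    · simp [h] at hw
    · rw [← h, hw]
  have hsubdom : ∀ w ∈ L₀.dom, w ∈ L.dom := by
    intro w hw
    obtain ⟨M, A, h⟩ := Labeling.exists_of_mem_dom hw
    exact Labeling.mem_dom (hsub _ _ h)
  have haL : a ∉ L.dom := fun h => lt_irrefl _ (hdel a h ha₀)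
  have hdom : ∀ w, w ∈ L'.dom ↔ w = a ∨ w ∈ L₀.dom := by
    intro w
    by_cases hw : w = a
    · simp [hw, Labeling.mem_dom hL'a]
    · simp [hw, Labeling.dom, hL'w w hw]
  have hcases : ∀ w M₁ A₁, L' w = some (M₁, A₁) →
      (w = a ∧ M₁ = M ∪ M' ∧ A₁ = A ++ [B]) ∨ (w ≠ a ∧ L₀ w = some (M₁, A₁)) := by
    intro w M₁ A₁ hw
    by_cases hwa : w = a
    · subst hwa
      rw [hL'a] at hw
      simp at hw
      exact .inl ⟨rfl, hw.1.symm, hw.2.symm⟩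
    · exact .inr ⟨hwa, hL'w w hwa ▸ hw⟩
  obtain ⟨hvM, hvc, hvA, hvB⟩ := hL.pos.label_valid _ _ _ (hsub _ _ hu)
  have hpos : IsPosition n C T L' := by
    constructor
    · exact (hdom _).2 (.inr (hcl _ u List.nil_prefix (Labeling.mem_dom hu)))
    · intro v hv
      rcases (hdom v).1 hv with rfl | hv
      · exact hT
      · exact hL.pos.dom_subset v (hsubdom v hv)
    · intro v w hvw hw
      rcases (hdom w).1 hw with rfl | hw
      · rcases List.prefix_concat_iff.1 hvw with rfl | hvw
        · exact hw
        · exact (hdom _).2 (.inr (hcl _ u hvw (Labeling.mem_dom hu)))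
      · exact (hdom _).2 (.inr (hcl _ w hvw hw))
    · intro v M₁ A₁ hv
      rcases hcases _ _ _ hv with ⟨rfl, rfl, rfl⟩ | ⟨-, hv⟩
      · refine ⟨hM, ?_, by simp [ha, hvA], ?_⟩
        · have := Finset.card_union_le M M'
          simp only [ha, List.length_append, List.length_singleton, mul_add, mul_one]
          omega
        · intro b hb
          rcases List.mem_append.1 hb with hb | hb
          · exact hvB b hb
          · obtain rfl := List.mem_singleton.1 hb
            exact hB
      · exact hL.pos.label_valid _ _ _ (hsub _ _ hv)
    · intro v w M₁ A₁ M₂ A₂ hvw hv hw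
      rcases hcases _ _ _ hw with ⟨rfl, rfl, rfl⟩ | ⟨hwa, hw⟩
      · rcases List.prefix_concat_iff.1 hvw with rfl | hvw
        · rw [hw] at hv
          simp at hv
          obtain ⟨rfl, rfl⟩ := hv
          exact ⟨subset_rfl, List.prefix_rfl⟩
        · have hva : v ≠ a := by
            rintro rfl
            have := hvw.length_le
            simp [ha] at this
          rw [hL'w v hva] at hv
          obtain ⟨h₁, h₂⟩ := hL.pos.label_mono _ _ _ _ _ _ hvw (hsub _ _ hv) (hsub _ _ hu)
          exact ⟨h₁.trans Finset.subset_union_left, h₂.trans (List.prefix_append _ _)⟩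
      · rcases hcases _ _ _ hv with ⟨rfl, -, -⟩ | ⟨-, hv⟩
        · exact (ha₀ (hcl _ _ hvw (Labeling.mem_dom hw))).elim
        · exact hL.pos.label_mono _ _ _ _ _ _ hvw (hsub _ _ hv) (hsub _ _ hw)
  -- Subtrees to the left of the new vertex are untouched, so the old frontiers kept for
  -- backtracking stay greatest in their subtrees.
  have hset : ∀ x k', x ++ [k' + 1] ≤ a →
      {w ∈ L'.dom | x ++ [k'] <+: w} = {w ∈ L.dom | x ++ [k'] <+: w} := by
    intro x k' hx
    ext w
    constructor
    · rintro ⟨hw, hxw⟩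
      rcases (hdom w).1 hw with rfl | hw
      · exact absurd (List.lt_of_prefix_of_prefix_succ hxw List.prefix_rfl) (not_lt.2 hx)
      · exact ⟨hsubdom _ hw, hxw⟩
    · rintro ⟨hw, hxw⟩
      refine ⟨(hdom w).2 (.inr ?_), hxw⟩
      by_contra hw₀
      exact lt_irrefl _ (((hdel w hw hw₀).trans
        (List.lt_of_prefix_of_prefix_succ hxw List.prefix_rfl)).trans_le hx)
  refine ⟨⟨hpos, ?_, ?_⟩, ?_⟩
  · intro v M₁ A₁ hv
    rcases hcases _ _ _ hv with ⟨rfl, rfl, rfl⟩ | ⟨-, hv⟩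
    · exact he
    · exact hL.evidence _ _ _ (hsub _ _ hv)
  · intro x k M₁ A₁ I χ i hx hn hA hf
    rcases hcases _ _ _ hx with ⟨hxa, rfl, rfl⟩ | ⟨-, hx⟩
    · obtain ⟨rfl, hk⟩ := List.append_inj' hxa rfl
      obtain rfl : k = j := by simpa using hk
      rw [← hvA] at hA
      obtain ⟨k', l, rfl, hl⟩ := hleft I χ i hn (by simpa using hA) hf
      exact ⟨k', l, rfl, hset x k' le_rfl ▸ hl⟩
    · obtain ⟨k', l, rfl, hl⟩ := hL.left x k _ _ I χ i (hsub _ _ hx) hn hA hf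
      exact ⟨k', l, rfl, hset x k' (hmax _ (Labeling.mem_dom hx)).le ▸ hl⟩
  · refine domKey_lt hT haL (Labeling.mem_dom hL'a) fun w hw hw' => hdel w hw fun h => hw' ?_
    exact (hdom w).2 (.inr h)

/-! ### Prover's strategy and one round of play -/

open Classical in
/-- The strategy of Prover that preserves the invariant. -/
noncomputable def proofStrategy (n C : ℕ) (T : Finset (List ℕ))
    (Γ : List ℕ → Cedent (Fin (n + 1) × Fin n)) : ProverStrategy n where
  query v M A :=
    if h : ∃ Q : Query n, Q.card ≤ binLen n ^ C ∧ ∀ M', IsMinimalCover Q M' →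
      ∃ mv : Move, mv.IsLegal n C v ∧ GoodMove T Γ v M A M' mv
    then h.choose else ∅
  move v M A M' :=
    if h : ∃ mv : Move, mv.IsLegal n C v ∧ GoodMove T Γ v M A M' mv
    then h.choose else .climb 1 1

theorem isObliviousStrategy_proofStrategy :
    IsObliviousStrategy n C (proofStrategy n C T Γ) := by
  intro v M A _ _ _ _ _
  refine ⟨?_, fun M' _ => ?_⟩
  · unfold proofStrategy
    dsimp only
    split_ifs with h
    · exact h.choose_spec.1
    · simp
  · unfold proofStrategy
    dsimp only
    split_ifs with h
    · exact h.choose_spec.1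
    · have := Nat.one_le_two_pow (n := binLen n ^ C)
      exact ⟨⟨le_rfl, this⟩, le_rfl, this⟩

theorem proofStrategy_spec (h : IsNormalProof n c z T Γ) (ht : 2 ≤ binLen n ^ C)
    (hz : z ≤ 2 ^ binLen n ^ C) {v : List ℕ} {M : EdgeSet n} {A : List ℕ} (hv : v ∈ T)
    (hM : IsMatching M) (hA : A.length = v.length) (he : Evidence Γ v M A) :
    ((proofStrategy n C T Γ).query v M A).card ≤ binLen n ^ C ∧
      ∀ M', IsMinimalCover ((proofStrategy n C T Γ).query v M A) M' →
        ((proofStrategy n C T Γ).move v M A M').IsLegal n C v ∧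
        GoodMove T Γ v M A M' ((proofStrategy n C T Γ).move v M A M') := by
  have h := exists_query_goodMove h ht hz hv hM hA he
  have hq : (proofStrategy n C T Γ).query v M A = h.choose := by
    unfold proofStrategy
    exact dif_pos h
  rw [hq]
  refine ⟨h.choose_spec.1, fun M' hM' => ?_⟩
  have hm := h.choose_spec.2 M' hM'
  have hm' : (proofStrategy n C T Γ).move v M A M' = hm.choose := by
    unfold proofStrategy
    exact dif_pos hm
  rw [hm']
  exact hm.choose_spec

/-- Losing outcomes do not arise: for a climb or an advance the good move itself guarantees the
target vertex, for a backtrack the field `left` does. -/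
theorem GameInvariant.playRound {L : Labeling n} (hL : GameInvariant n C T Γ L)
    (h : IsNormalProof n c z T Γ) (ht : 2 ≤ binLen n ^ C) (hz : z ≤ 2 ^ binLen n ^ C)
    {g : Labeling n → Query n → EdgeSet n} (hg : IsDelayerStrategy n C T g) :
    PlayRound T (proofStrategy n C T Γ) g L .proverWins ∨
      ∃ L', PlayRound T (proofStrategy n C T Γ) g L (.next L') ∧ GameInvariant n C T Γ L' ∧
        domKey T L < domKey T L' := by
  obtain ⟨v, hv⟩ := hL.pos.exists_isGreatest
  obtain ⟨M, A, hvL⟩ := Labeling.exists_of_mem_dom hv.1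
  obtain ⟨hM, -, hA, -⟩ := hL.pos.label_valid _ _ _ hvL
  obtain ⟨hq, hspec⟩ := proofStrategy_spec h ht hz (hL.pos.dom_subset v hv.1) hM hA
    (hL.evidence _ _ _ hvL)
  have hg := hg L hL.pos _ hq
  obtain ⟨hlegal, hgood⟩ := hspec _ hg
  have hcard := hg.card_le.trans hq
  suffices H : Round T L (g L ((proofStrategy n C T Γ).query v M A))
      ((proofStrategy n C T Γ).move v M A (g L ((proofStrategy n C T Γ).query v M A)))
      .proverWins ∨ ∃ L', Round T L (g L ((proofStrategy n C T Γ).query v M A))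
      ((proofStrategy n C T Γ).move v M A (g L ((proofStrategy n C T Γ).query v M A)))
      (.next L') ∧ GameInvariant n C T Γ L' ∧ domKey T L < domKey T L' by
    rcases H with H | ⟨L', H, H'⟩
    · exact .inl ⟨v, M, A, hv, hvL, H⟩
    · exact .inr ⟨L', ⟨v, M, A, hv, hvL, H⟩, H'⟩
  generalize g L ((proofStrategy n C T Γ).query v M A) = M' at hlegal hgood hcard ⊢
  generalize (proofStrategy n C T Γ).move v M A M' = mv at hlegal hgood ⊢
  clear hg hspec hq
  cases hgood with
  | climb y B hT he hflat =>
    by_cases hc : Contradicts M M'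
    · exact .inl (.climb_win v M A y B hv hT hvL hc)
    refine .inr ⟨_, .climb_next v M A y B hv hT hvL hc, ?_⟩
    refine hL.step (fun w => .inr rfl) hL.pos.dom_closed hvL hT
      (fun w hw => (hv.2 hw).trans_lt (List.lt_append_singleton v y))
      (fun w hw hw' => (hw' hw).elim) (not_not.1 hc) hcard hlegal.2 he ?_
    intro I χ i hn _ hf
    exact (hf (hflat I χ i hn)).elim
  | advance x σ k B hvx hT he hT' hleft =>
    subst hvx
    have hxk : x ++ [k] <+: x ++ [k] ++ σ := List.prefix_append _ _
    obtain ⟨M₀, A₀, hx⟩ := Labeling.exists_of_mem_dom (hL.pos.dom_closed x _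
      ((List.prefix_append x [k]).trans hxk) hv.1)
    by_cases hc : Contradicts M₀ M'
    · exact .inl (.advance_win x σ k B M₀ A₀ hv hT hx hc)
    refine .inr ⟨_, .advance_next x σ k B M₀ A₀ hv hT hx hc, ?_⟩
    have hA₀ := (hL.pos.label_valid _ _ _ hx).2.2.1
    refine hL.step (fun w => .inr rfl) hL.pos.dom_closed hx hT
      (fun w hw => (hv.2 hw).trans_lt (List.lt_of_prefix_of_prefix_succ hxk List.prefix_rfl))
      (fun w hw hw' => (hw' hw).elim) (not_not.1 hc) hcard hlegal.2
      (he M₀ A₀ hA₀ (hL.evidence _ _ _ hx)) ?_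
    intro I χ i hn hB _
    -- The frontier left behind is greatest in the whole domain, hence in the subtree above `x ++
    -- [k]`.
    exact ⟨k, _, rfl, ⟨⟨hv.1, hxk⟩, fun w hw => hv.2 hw.1⟩, hT', hleft I χ i hn hB⟩
  | backtrack x σ k hvx I χ i hn hAi J ψ hχ j hψ hf =>
    subst hvx
    have hxk : x ++ [k] <+: x ++ [k] ++ σ := List.prefix_append _ _
    obtain ⟨M₁, A₁, hx⟩ := Labeling.exists_of_mem_dom (hL.pos.dom_closed _ _ hxk hv.1)
    -- The index seen at the frontier was already recorded in the label of `x ++ [k]`, where `left`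
    -- applies.
    have hA₁ : A₁[x.length]? = some (i.1 + 1) := by
      have hpre := (hL.pos.label_mono _ _ _ _ _ _ hxk hx hvL).2
      have hlen := (hL.pos.label_valid _ _ _ hx).2.2.1
      obtain ⟨s, rfl⟩ := hpre
      rwa [List.getElem?_append_left (by simp [hlen])] at hAi
    obtain ⟨k', l, rfl, hl, hlT, hΓ⟩ := hL.left x k M₁ A₁ I χ i hx hn hA₁
      (by rw [hχ]; exact fun h => h)
    obtain ⟨M₀, A₀, hlL⟩ := Labeling.exists_of_mem_dom hl.1.1
    have hA₀ := (hL.pos.label_valid _ _ _ hlL).2.2.1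
    by_cases hc : Contradicts M₀ M'
    · exact .inl (.backtrack_win x σ l (k' + 1) _ M₀ A₀ hv hl ⟨1, hlT⟩ hlL hc)
    refine .inr ⟨_, .backtrack_next x σ l (k' + 1) _ M₀ A₀ hv hl ⟨1, hlT⟩ hlL hc, ?_⟩
    have hl₁ : x ++ [k'] <+: l ++ [1] := hl.1.2.trans (List.prefix_append _ _)
    have hdom : ∀ w, w ∈ Labeling.dom (fun w => if x ++ [k' + 1] <+: w then none else L w) ↔
        ¬ x ++ [k' + 1] <+: w ∧ w ∈ L.dom := by
      intro w
      by_cases hw : x ++ [k' + 1] <+: w <;> simp [Labeling.dom, hw]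
    have hlx : ¬ x ++ [k' + 1] <+: l := fun hlx =>
      lt_irrefl _ (List.lt_of_prefix_of_prefix_succ hl.1.2 hlx)
    rw [hχ] at hΓ
    -- Backtracking amounts to a climb from `l`: the new conjunction is `(χ i).compl`, and `M'`
    -- falsifies its conjunct `j`.
    have hgood : GoodMove T Γ l M₀ A₀ M' (.climb 1 (j.1 + 1)) := by
      refine .climb_of_insert (hL.evidence _ _ _ hlL) hA₀ hlT hΓ (fun hf => hf.elim) ?_ ?_
      · intro I' χ' e
        cases e
        exact ⟨fun i => (Formula.isFlat_compl _).2 (hψ i), j, rfl,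
          hf.mono Finset.subset_union_right⟩
      · intro I' χ' _ e
        cases e
    cases hgood with
    | climb _ _ _ he hflat =>
      refine hL.step (fun w => ?_) (fun a b hab hb => ?_) (by simp [hlx, hlL]) hlT
        (fun w hw => ?_) (fun w hw hw' => ?_) (not_not.1 hc) hcard hlegal.2 he ?_
      · split_ifs
        · exact .inl rfl
        · exact .inr rfl
      · rw [hdom] at hb ⊢
        exact ⟨fun h => hb.1 (h.trans hab), hL.pos.dom_closed _ _ hab hb.2⟩
      · rw [hdom] at hw
        by_contra hlt
        have hle := not_lt.1 hlt
        -- A remaining vertex not below `l ++ [1]` would lie in the left subtree, against the choice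
        -- of `l`, or in the deleted one.
        rcases List.prefix_of_le_of_le hl₁ hxk hle (hv.2 hw.2) with hw' | hw'
        · exact absurd (hl.2 ⟨hw.2, hw'⟩)
            (not_le.2 ((List.lt_append_singleton l 1).trans_le hle))
        · exact hw.1 hw'
      · rw [hdom] at hw'
        have hxw : x ++ [k' + 1] <+: w := by
          by_contra hxw
          exact hw' ⟨hxw, hw⟩
        exact List.lt_of_prefix_of_prefix_succ hl₁ hxw
      · intro I' χ' i' hn' _ hf'
        exact (hf' (hflat I' χ' i' hn')).elim

/-! ### Termination and the initial position -/

theorem GameInvariant.winsFrom {L : Labeling n} (hL : GameInvariant n C T Γ L)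
    (h : IsNormalProof n c z T Γ) (ht : 2 ≤ binLen n ^ C) (hz : z ≤ 2 ^ binLen n ^ C)
    {g : Labeling n → Query n → EdgeSet n} (hg : IsDelayerStrategy n C T g) :
    WinsFrom T (proofStrategy n C T Γ) g L := by
  classical
  -- The induction is on the number of subsets of `T` above the current domain; the new domain
  -- leaves this set in each round.
  let S : Labeling n → Finset (Finset (List ℕ)ᵒᵈ) := fun L =>
    (T.map OrderDual.toDual.toEmbedding).powerset.filter fun s => domKey T L < toColex s
  induction hm : (S L).card using Nat.strong_induction_on generalizing L with
  | _ m ih =>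
    rcases hL.playRound h ht hz hg with hw | ⟨L', hr, hL', hlt⟩
    · exact .now L hw
    · refine .later L L' hr (ih _ ?_ hL' rfl)
      rw [← hm]
      refine Finset.card_lt_card (Finset.ssubset_iff_of_subset ?_ |>.2
        ⟨ofColex (domKey T L'), ?_, ?_⟩)
      · intro s hs
        rw [Finset.mem_filter] at hs ⊢
        exact ⟨hs.1, hlt.trans hs.2⟩
      · refine Finset.mem_filter.2 ⟨Finset.mem_powerset.2 ?_, hlt⟩
        exact Finset.map_subset_map.2 (Finset.filter_subset _ _)
      · intro hs
        exact lt_irrefl _ (Finset.mem_filter.1 hs).2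

theorem gameInvariant_initialPosition (h : IsNormalProof n c z T Γ) :
    GameInvariant n C T Γ (initialPosition n) := by
  have hcases : ∀ v M A, initialPosition n v = some (M, A) → v = [] ∧ M = ∅ ∧ A = [] := by
    intro v M A hv
    unfold initialPosition at hv
    split_ifs at hv with h
    simp at hv
    exact ⟨h, hv.1.symm, hv.2⟩
  have hdom : ∀ v, v ∈ (initialPosition n).dom ↔ v = [] := by
    intro v
    simp [Labeling.dom, initialPosition]
  constructor
  · constructor
    · simp [hdom]
    · intro v hv
      rw [(hdom v).1 hv]
      exact h.nil_mem
    · intro v w hvw hw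
      rw [(hdom w).1 hw] at hvw
      exact (hdom v).2 (List.prefix_nil.1 hvw)
    · intro v M A hv
      obtain ⟨rfl, rfl, rfl⟩ := hcases _ _ _ hv
      simp [IsMatching, EntriesBounded]
    · intro v w M A M' A' _ hv hw
      obtain ⟨rfl, rfl, rfl⟩ := hcases _ _ _ hv
      obtain ⟨rfl, rfl, rfl⟩ := hcases _ _ _ hw
      simp
  · intro v M A hv
    obtain ⟨rfl, rfl, rfl⟩ := hcases _ _ _ hv
    refine ⟨fun φ hφ hf => ?_, fun x k I χ hx => ?_, fun x k I χ j hx => ?_⟩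
    · rw [h.root] at hφ
      obtain ⟨_, _, rfl⟩ := exists_bigOr_of_mem_ontoPHP hφ
      exact hf.elim
    · simp at hx
    · simp at hx
  · intro x k M A I χ i hx
    have := (hcases _ _ _ hx).1
    simp at this

end

/-! ### The theorem -/

theorem two_le_binLen {n : ℕ} (hn : 2 ≤ n) : 2 ≤ binLen n :=
  (Nat.lt_clog_iff_pow_lt Nat.one_lt_two).2 (by omega)

theorem mainTheorem1
    (h : ∃ c K : ℕ, ∀ᶠ n : ℕ in atTop, ∃ π : LabeledTree (Fin (n + 1) × Fin n),
      IsDerivation 2 c π (ontoPHP n) ∧ π.size ≤ 2 ^ binLen n ^ K) :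
    ∃ C : ℕ, 0 < C ∧ ∀ᶠ n : ℕ in atTop, ∃ T : Finset (List ℕ), IsNCTree n C T ∧
      ∃ f : ProverStrategy n, IsObliviousStrategy n C f ∧
        ∀ g : Labeling n → Query n → EdgeSet n, IsDelayerStrategy n C T g → Beats T f g := by
  obtain ⟨c, K, h⟩ := h
  -- The constant bounds the height `c` and the exponent `K`; being positive, it also gives `2 ≤
  -- |n|^C`, room for the queries on the axioms.
  refine ⟨c + K + 1, by omega, ?_⟩
  filter_upwards [h, eventually_ge_atTop 2] with n hn hn2
  obtain ⟨π, hπ, hsize⟩ := hn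
  obtain ⟨T, Γ, hT⟩ := hπ.exists_isNormalProof
  have hlen := two_le_binLen hn2
  have ht : 2 ≤ binLen n ^ (c + K + 1) := hlen.trans (Nat.le_self_pow (by omega) _)
  have hz : π.size ≤ 2 ^ binLen n ^ (c + K + 1) :=
    hsize.trans (Nat.pow_le_pow_right two_pos (Nat.pow_le_pow_right (by omega) (by omega)))
  refine ⟨T, ⟨⟨hT.rooted.1, fun v hv => ?_, hT.rooted.2.2⟩, fun v k l hk hl hlk =>
    hT.sibling_mem hk hl hlk⟩, proofStrategy n _ T Γ, isObliviousStrategy_proofStrategy,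
    fun g hg => (gameInvariant_initialPosition hT).winsFrom hT ht hz hg⟩
  obtain ⟨h₁, h₂⟩ := hT.rooted.2.1 v hv
  exact ⟨by omega, fun a ha => ⟨(h₂ a ha).1, (h₂ a ha).2.trans hz⟩⟩
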